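/- Let $M^3$ be a connected smooth $3$-manifold and $x : M^3 \to \mathbb{E}^4$ a smooth immersion into Euclidean $4$-space; equip $M$ with the induced metric, and let $h$ be its second fundamental form. For $p \in M$ and an orthonormal basis $e_1,e_2,e_3$ of $T_pM$ let $\rho = \frac{1}{3}\sum_{i<j}K(e_i\wedge e_j)$ be the normalized scalar curvature ($K$ being the sectional curvature of $M$), let $\mathcal{C} = \frac13\sum_{i,j=1}^{3}\|h(e_i,e_j)\|^2$ be the Casorati curvature, and for a plane $L\subset T_pM$ with orthonormal basis $f_1,f_2$ let $\mathcal{C}(L)=\frac12\sum_{i,j=1}^{2}\|h(f_i,f_j)\|^2$. Put $$\delta_C(2) = \tfrac12\,\mathcal{C} + \tfrac23\,\inf\{\mathcal{C}(L) \mid L \text{ a plane in } T_pM\}.$$ Suppose that $M$ is Casorati ideal, i.e. that equality $\rho = \delta_C(2)$ holds in the inequality $\rho\le\delta_C(2)$ at every point of $M$, and that $M$ is not totally geodesic (i.e. $h$ does not vanish identically). Then there is a real number $a>0$ such that, up to an isometry of $\mathbb{E}^4$, $M$ is (immersed as) an open part of the rotational hypersurface $\Sigma_a$ parametrized by $$\Big(\tfrac1a\,\mathrm{sd}\big(at,\tfrac1{\sqrt2}\big)\sin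 u,\ \tfrac1a\,\mathrm{sd}\big(at,\tfrac1{\sqrt2}\big)\cos u\sin v,\ \tfrac1a\,\mathrm{sd}\big(at,\tfrac1{\sqrt2}\big)\cos u\cos v,\ \tfrac12\int_0^t \mathrm{sd}^2\big(as,\tfrac1{\sqrt2}\big)\,ds\Big),$$ $0<t<2K/a$, $u,v\in\mathbb{R}$; that is, for some isometry $T$ of $\mathbb{E}^4$ the map $T\circ x$ takes values in $\Sigma_a$ and is a local homeomorphism $M\to\Sigma_a$. Here $\mathrm{sd}(\cdot,k)=\mathrm{sn}(\cdot,k)/\mathrm{dn}(\cdot,k)$ is Jacobi's elliptic function of modulus $k$, and $K=\int_0^{\pi/2}\big(1-\tfrac12\sin^2\theta\big)^{-1/2}d\theta$ is the complete elliptic integral of the first kind of modulus $1/\sqrt2$ (so that $\mathrm{sd}(at,1/\sqrt2)$ is positive for $0<t<2K/a$ and vanishes at both ends). -/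

import Mathlib

open Set Filter Topology
open scoped ContDiff Manifold RealInnerProductSpace

noncomputable section

/-- `𝔼 n` is Euclidean `n`-space. -/
notation "𝔼" n:max => EuclideanSpace ℝ (Fin n)

namespace Casorati

/-! ### Riemannian geometry of a local parametrization

`X : 𝔼 n → 𝔼 m` is a parametrized piece of a submanifold of Euclidean space; `y` is a point of its
parameter domain, and tangent vectors at `y` are written in coordinates, as elements of `𝔼 n`. -/

section Local

variable {n m : ℕ}

/-- The `i`-th coordinate vector of the parameter space. -/
def coordVec (i : Fin n) : 𝔼 n := EuclideanSpace.single i 1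

/-- The partial derivative `∂_i f`. -/
def pderiv (i : Fin n) (f : 𝔼 n → ℝ) (y : 𝔼 n) : ℝ := fderiv ℝ f y (coordVec i)

/-- The induced metric (first fundamental form) `g_y(v, w) = ⟨dX v, dX w⟩`. -/
def metric (X : 𝔼 n → 𝔼 m) (y v w : 𝔼 n) : ℝ := ⟪fderiv ℝ X y v, fderiv ℝ X y w⟫

/-- The matrix `(g_ij)` of the induced metric. -/
def gram (X : 𝔼 n → 𝔼 m) (y : 𝔼 n) : Matrix (Fin n) (Fin n) ℝ :=
  Matrix.of fun i j => metric X y (coordVec i) (coordVec j)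

/-- The Christoffel symbol `Γ^k_{ij}` of the Levi-Civita connection of the induced metric. -/
def christoffel (X : 𝔼 n → 𝔼 m) (k i j : Fin n) (y : 𝔼 n) : ℝ :=
  (1 / 2) * ∑ l, (gram X y)⁻¹ k l *
    (pderiv i (fun z => gram X z j l) y + pderiv j (fun z => gram X z i l) y
      - pderiv l (fun z => gram X z i j) y)

/-- The components of the Riemann tensor of the induced metric:
`R(∂_i, ∂_j) ∂_k = ∑ l, (riemann X l k i j) ∂_l`, where
`R(U, V) W = ∇_U ∇_V W - ∇_V ∇_U W - ∇_[U,V] W`. -/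
def riemann (X : 𝔼 n → 𝔼 m) (l k i j : Fin n) (y : 𝔼 n) : ℝ :=
  pderiv i (christoffel X l j k) y - pderiv j (christoffel X l i k) y
    + ∑ p, (christoffel X l i p y * christoffel X p j k y
      - christoffel X l j p y * christoffel X p i k y)

/-- The curvature `g(R(u, v) w, z)` of the induced metric. -/
def curvature (X : 𝔼 n → 𝔼 m) (y u v w z : 𝔼 n) : ℝ :=
  ∑ i, ∑ j, ∑ k, ∑ l, ∑ q, u i * v j * w k * z q * riemann X l k i j y * gram X y l q

/-- The sectional curvature `K(u ∧ v)` of the induced metric. -/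
def sectionalCurvature (X : 𝔼 n → 𝔼 m) (y u v : 𝔼 n) : ℝ :=
  curvature X y u v v u / (metric X y u u * metric X y v v - metric X y u v ^ 2)

/-- The second fundamental form `h(v, w)`: the component of `∂_v ∂_w X` normal to the tangent space
`dX (𝔼 n)`. -/
def secondFF (X : 𝔼 n → 𝔼 m) (y v w : 𝔼 n) : 𝔼 m :=
  ((fderiv ℝ X y).range)ᗮ.starProjection (fderiv ℝ (fun z => fderiv ℝ X z w) y v)

/-- `e` is a family of tangent vectors at `y` that is orthonormal for the induced metric. -/
def IsOrthonormalFamily (X : 𝔼 n → 𝔼 m) (y : 𝔼 n) {l : ℕ} (e : Fin l → 𝔼 n) : Prop :=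
  Orthonormal ℝ fun i => fderiv ℝ X y (e i)

/-- The normalized scalar curvature `ρ = (2 / (n (n - 1))) ∑_{i < j} K(e_i ∧ e_j)`, computed in the
orthonormal frame `e`. -/
def normalizedScalarCurvature (X : 𝔼 n → 𝔼 m) (y : 𝔼 n) (e : Fin n → 𝔼 n) : ℝ :=
  2 / ((n : ℝ) * ((n : ℝ) - 1)) *
    ∑ i, ∑ j ∈ Finset.univ.filter (fun j => i < j), sectionalCurvature X y (e i) (e j)

/-- The Casorati curvature `C(L) = (1 / l) ∑_{i, j} ‖h(e_i, e_j)‖ ^ 2` of the `l`-dimensional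
tangent subspace `L` with orthonormal basis `e`; for `l = n` it is the Casorati curvature `C`. -/
def casorati (X : 𝔼 n → 𝔼 m) (y : 𝔼 n) {l : ℕ} (e : Fin l → 𝔼 n) : ℝ :=
  1 / (l : ℝ) * ∑ i, ∑ j, ‖secondFF X y (e i) (e j)‖ ^ 2

/-- The normalized `δ`-Casorati curvature
`δ_C(n - 1) = C / 2 + ((n + 1) / (2 n)) inf {C(L) | L a hyperplane of the tangent space}`,
with `C` computed in the orthonormal frame `e`. Hyperplanes `L` of the tangent space are given by
their orthonormal bases `f`. -/
def deltaCasorati (X : 𝔼 n → 𝔼 m) (y : 𝔼 n) (e : Fin n → 𝔼 n) : ℝ :=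
  1 / 2 * casorati X y e + ((n : ℝ) + 1) / (2 * (n : ℝ)) *
    sInf {c | ∃ f : Fin (n - 1) → 𝔼 n, IsOrthonormalFamily X y f ∧ c = casorati X y f}

end Local

/-! ### Submanifolds of Euclidean space -/

section Submanifold

variable {n m : ℕ} {M : Type*} [TopologicalSpace M] [ChartedSpace (𝔼 n) M]

/-- `x : M → 𝔼 m` is a smooth immersion. -/
def IsSmoothImmersion (x : M → 𝔼 m) : Prop :=
  ContMDiff 𝓘(ℝ, 𝔼 n) 𝓘(ℝ, 𝔼 m) ∞ x ∧
    ∀ p : M, Function.Injective (mfderiv 𝓘(ℝ, 𝔼 n) 𝓘(ℝ, 𝔼 m) x p)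

/-- Equality `ρ = δ_C(n - 1) + c` holds at every point of the immersed submanifold, where `c = 0` is
the curvature of Euclidean space. Both sides depend neither on the chart nor on the orthonormal
frame in which they are computed. -/
def IsCasoratiIdeal (x : M → 𝔼 m) : Prop :=
  ∀ φ ∈ atlas (𝔼 n) M, ∀ p ∈ φ.source, ∀ e : Fin n → 𝔼 n,
    IsOrthonormalFamily (x ∘ φ.symm) (φ p) e →
      normalizedScalarCurvature (x ∘ φ.symm) (φ p) e = deltaCasorati (x ∘ φ.symm) (φ p) e

/-- The second fundamental form vanishes identically. -/
def IsTotallyGeodesic (x : M → 𝔼 m) : Prop :=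
  ∀ φ ∈ atlas (𝔼 n) M, ∀ p ∈ φ.source, ∀ v w : 𝔼 n, secondFF (x ∘ φ.symm) (φ p) v w = 0

end Submanifold

/-! ### Jacobi's elliptic functions with modulus `k` -/

/-- The incomplete elliptic integral of the first kind `F(θ, k)`. -/
def ellipticF (k θ : ℝ) : ℝ := ∫ s in (0 : ℝ)..θ, 1 / √(1 - k ^ 2 * Real.sin s ^ 2)

/-- The complete elliptic integral of the first kind `K(k) = F(π / 2, k)`. -/
def ellipticK (k : ℝ) : ℝ := ellipticF k (Real.pi / 2)

/-- For `|k| < 1` the function `F(·, k)` is a bijection of the real line, so its inverse exists. -/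
theorem ellipticF_bijective {k : ℝ} (hk : |k| < 1) : Function.Bijective (ellipticF k) := by
  have hk2 : k ^ 2 < 1 := (sq_lt_one_iff_abs_lt_one k).2 hk
  have hpos : ∀ s : ℝ, 0 < 1 - k ^ 2 * Real.sin s ^ 2 := fun s => by
    nlinarith [Real.sin_sq_le_one s, sq_nonneg (Real.sin s), sq_nonneg k]
  have hcont : Continuous fun s : ℝ => 1 / √(1 - k ^ 2 * Real.sin s ^ 2) :=
    continuous_const.div (by fun_prop) fun s => (Real.sqrt_pos.2 (hpos s)).ne'
  have hge : ∀ s : ℝ, 1 ≤ 1 / √(1 - k ^ 2 * Real.sin s ^ 2) := fun s => by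
    rw [le_div_iff₀ (Real.sqrt_pos.2 (hpos s)), one_mul, Real.sqrt_le_iff]
    constructor <;> nlinarith [mul_nonneg (sq_nonneg k) (sq_nonneg (Real.sin s))]
  have hgrow : ∀ a b : ℝ, a ≤ b → b - a ≤ ellipticF k b - ellipticF k a := fun a b hab => by
    unfold ellipticF
    rw [intervalIntegral.integral_interval_sub_left (hcont.intervalIntegrable _ _)
      (hcont.intervalIntegrable _ _)]
    calc b - a = ∫ _ in a..b, (1 : ℝ) := by simp
      _ ≤ _ := intervalIntegral.integral_mono_on hab (by simp) (hcont.intervalIntegrable _ _)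
        fun s _ => hge s
  have h0 : ellipticF k 0 = 0 := by simp [ellipticF]
  have hmono : StrictMono (ellipticF k) := fun a b hab => by linarith [hgrow a b hab.le]
  have hFc : Continuous (ellipticF k) :=
    intervalIntegral.continuous_primitive (fun a b => hcont.intervalIntegrable a b) 0
  refine ⟨hmono.injective, hFc.surjective ?_ ?_⟩
  · refine tendsto_atTop_mono' _ ?_ tendsto_id
    filter_upwards [eventually_ge_atTop 0] with s hs
    simpa [h0] using hgrow 0 s hs
  · refine tendsto_atBot_mono' _ ?_ tendsto_id
    filter_upwards [eventually_le_atBot 0] with s hs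
    have := hgrow s 0 hs
    simp only [h0, id] at *
    linarith

/-- Jacobi's amplitude `am(·, k)`, the inverse of `F(·, k)`. -/
def jacobiAm (k : ℝ) : ℝ → ℝ := Function.invFun (ellipticF k)

def jacobiSn (u k : ℝ) : ℝ := Real.sin (jacobiAm k u)

def jacobiDn (u k : ℝ) : ℝ := √(1 - k ^ 2 * jacobiSn u k ^ 2)

def jacobiSd (u k : ℝ) : ℝ := jacobiSn u k / jacobiDn u k

/-! ### The model hypersurface -/

/-- The parametrization of the rotational hypersurface with parameter `a`. -/
def rotParam (a t u v : ℝ) : 𝔼 4 :=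
  !₂[1 / a * jacobiSd (a * t) (1 / √2) * Real.sin u,
     1 / a * jacobiSd (a * t) (1 / √2) * Real.cos u * Real.sin v,
     1 / a * jacobiSd (a * t) (1 / √2) * Real.cos u * Real.cos v,
     1 / 2 * ∫ s in (0 : ℝ)..t, jacobiSd (a * s) (1 / √2) ^ 2]

/-- The rotational hypersurface with parameter `a`. The interval `0 < t < 2 K / a` lies between two
consecutive zeros of `sd(a t, 1 / √2)`, where the profile curve meets the axis. -/
def rotHypersurface (a : ℝ) : Set (𝔼 4) :=
  {q | ∃ t u v : ℝ, 0 < t ∧ t < 2 * ellipticK (1 / √2) / a ∧ q = rotParam a t u v}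

end Casorati

end

/-!
Equality in the Casorati inequality forces the principal curvatures to be `λ, …, λ, 2 λ`. Where
`h ≠ 0`, choose the unit normal `N` with `λ > 0`, let `ξ` be a unit principal vector of `2 λ` and
`θ` its dual one-form. The Codazzi equation gives `dλ = μ θ` and then `dμ = -2 λ³ θ`, so that the
energy `μ² + λ⁴ = a⁴ / 4`, the direction `λ² ξ + μ N` of the axis of rotation and a centre on this
axis are locally constant. They place the points on a rotational hypersurface whose radius `2 λ / a²`, as a
function of the arc length of the profile curve, satisfies the differential equation of
`t ↦ sd (a t) / a`.

To see that `h` has no zeros, note that `λ = tr A / (n + 1)`, with `A` the shape operator, is smooth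
also where `h = 0`, and that `∇²λ(v, v) = μ² / λ` for unit vectors `v` orthogonal to `ξ`. Hence
`μ² / λ` is bounded by a continuous function, and `λ → 0` is impossible while
`μ² + λ⁴ = a⁴ / 4 > 0`.
-/

noncomputable section

namespace Casorati

/-! ### Jacobi's elliptic functions -/

section Elliptic

theorem one_sub_sq_mul_sin_sq_pos {k : ℝ} (hk : |k| < 1) (s : ℝ) :
    0 < 1 - k ^ 2 * Real.sin s ^ 2 := by
  have hk2 : k ^ 2 < 1 := (sq_lt_one_iff_abs_lt_one k).2 hk
  nlinarith [Real.sin_sq_le_one s, sq_nonneg (Real.sin s), sq_nonneg k]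

theorem continuous_ellipticF_integrand {k : ℝ} (hk : |k| < 1) :
    Continuous fun s : ℝ => 1 / √(1 - k ^ 2 * Real.sin s ^ 2) :=
  continuous_const.div (by fun_prop) fun s =>
    (Real.sqrt_pos.2 (one_sub_sq_mul_sin_sq_pos hk s)).ne'

theorem hasStrictDerivAt_ellipticF {k : ℝ} (hk : |k| < 1) (θ : ℝ) :
    HasStrictDerivAt (ellipticF k) (1 / √(1 - k ^ 2 * Real.sin θ ^ 2)) θ :=
  (continuous_ellipticF_integrand hk).integral_hasStrictDerivAt 0 θ

theorem strictMono_ellipticF {k : ℝ} (hk : |k| < 1) : StrictMono (ellipticF k) :=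
  strictMono_of_deriv_pos fun θ => by
    rw [(hasStrictDerivAt_ellipticF hk θ).hasDerivAt.deriv]
    exact one_div_pos.2 (Real.sqrt_pos.2 (one_sub_sq_mul_sin_sq_pos hk θ))

theorem ellipticF_zero (k : ℝ) : ellipticF k 0 = 0 := intervalIntegral.integral_same

theorem ellipticF_pi {k : ℝ} (hk : |k| < 1) : ellipticF k Real.pi = 2 * ellipticK k := by
  have hc := continuous_ellipticF_integrand hk
  have hsymm : (∫ s in (Real.pi / 2)..Real.pi, 1 / √(1 - k ^ 2 * Real.sin s ^ 2)) =
      ellipticK k := by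
    have h := intervalIntegral.integral_comp_sub_left (a := Real.pi / 2) (b := Real.pi)
      (fun s => 1 / √(1 - k ^ 2 * Real.sin s ^ 2)) Real.pi
    simp only [Real.sin_pi_sub, sub_self, sub_half] at h
    exact h
  calc ellipticF k Real.pi
      = ellipticK k + ∫ s in (Real.pi / 2)..Real.pi, 1 / √(1 - k ^ 2 * Real.sin s ^ 2) :=
        (intervalIntegral.integral_add_adjacent_intervals (hc.intervalIntegrable _ _)
          (hc.intervalIntegrable _ _)).symm
    _ = 2 * ellipticK k := by rw [hsymm, two_mul]

theorem ellipticK_pos {k : ℝ} (hk : |k| < 1) : 0 < ellipticK k := by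
  have h := strictMono_ellipticF hk Real.pi_pos
  rw [ellipticF_zero, ellipticF_pi hk] at h
  linarith

theorem jacobiAm_ellipticF {k : ℝ} (hk : |k| < 1) (θ : ℝ) : jacobiAm k (ellipticF k θ) = θ :=
  Function.leftInverse_invFun (ellipticF_bijective hk).1 θ

theorem ellipticF_jacobiAm {k : ℝ} (hk : |k| < 1) (u : ℝ) : ellipticF k (jacobiAm k u) = u :=
  Function.rightInverse_invFun (ellipticF_bijective hk).2 u

theorem strictMono_jacobiAm {k : ℝ} (hk : |k| < 1) : StrictMono (jacobiAm k) := fun u v h => by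
  rwa [← (strictMono_ellipticF hk).lt_iff_lt, ellipticF_jacobiAm hk, ellipticF_jacobiAm hk]

theorem jacobiAm_zero {k : ℝ} (hk : |k| < 1) : jacobiAm k 0 = 0 := by
  simpa only [ellipticF_zero] using jacobiAm_ellipticF hk 0

theorem jacobiAm_two_mul_ellipticK {k : ℝ} (hk : |k| < 1) :
    jacobiAm k (2 * ellipticK k) = Real.pi := by
  rw [← ellipticF_pi hk, jacobiAm_ellipticF hk]

/-- Jacobi's elliptic function `cn`. -/
def jacobiCn (u k : ℝ) : ℝ := Real.cos (jacobiAm k u)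

theorem jacobiCn_sq (u k : ℝ) : jacobiCn u k ^ 2 = 1 - jacobiSn u k ^ 2 := Real.cos_sq' _

theorem jacobiDn_pos {k : ℝ} (hk : |k| < 1) (u : ℝ) : 0 < jacobiDn u k :=
  Real.sqrt_pos.2 (one_sub_sq_mul_sin_sq_pos hk _)

theorem jacobiDn_sq {k : ℝ} (hk : |k| < 1) (u : ℝ) :
    jacobiDn u k ^ 2 = 1 - k ^ 2 * jacobiSn u k ^ 2 :=
  Real.sq_sqrt (one_sub_sq_mul_sin_sq_pos hk _).le

theorem hasStrictDerivAt_jacobiAm {k : ℝ} (hk : |k| < 1) (u : ℝ) :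
    HasStrictDerivAt (jacobiAm k) (jacobiDn u k) u := by
  have h := (hasStrictDerivAt_ellipticF hk (jacobiAm k u)).to_local_left_inverse
    (one_div_pos.2 (Real.sqrt_pos.2 (one_sub_sq_mul_sin_sq_pos hk _))).ne'
    (Eventually.of_forall (jacobiAm_ellipticF hk))
  rw [ellipticF_jacobiAm hk] at h
  exact h.congr_deriv (by rw [one_div, inv_inv]; rfl)

theorem hasStrictDerivAt_jacobiSn {k : ℝ} (hk : |k| < 1) (u : ℝ) :
    HasStrictDerivAt (fun u => jacobiSn u k) (jacobiCn u k * jacobiDn u k) u :=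
  (hasStrictDerivAt_jacobiAm hk u).sin

theorem hasStrictDerivAt_jacobiCn {k : ℝ} (hk : |k| < 1) (u : ℝ) :
    HasStrictDerivAt (fun u => jacobiCn u k) (-jacobiSn u k * jacobiDn u k) u :=
  (hasStrictDerivAt_jacobiAm hk u).cos

theorem hasStrictDerivAt_jacobiDn {k : ℝ} (hk : |k| < 1) (u : ℝ) :
    HasStrictDerivAt (fun u => jacobiDn u k) (-(k ^ 2 * jacobiSn u k * jacobiCn u k)) u := by
  have h := ((((hasStrictDerivAt_jacobiSn hk u).pow 2).const_mul (k ^ 2)).const_sub 1).sqrt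
    (one_sub_sq_mul_sin_sq_pos hk _).ne'
  refine h.congr_deriv ?_
  change -(k ^ 2 * (((2 : ℕ) : ℝ) * jacobiSn u k ^ (2 - 1) * (_ * jacobiDn u k))) /
    (2 * jacobiDn u k) = _
  have := (jacobiDn_pos hk u).ne'
  simp only [Nat.add_one_sub_one, pow_one, Nat.cast_ofNat]
  field_simp

/-- The derivative `cn / dn ^ 2` of `sd`. -/
def jacobiSdDeriv (u k : ℝ) : ℝ := jacobiCn u k / jacobiDn u k ^ 2

theorem hasStrictDerivAt_jacobiSd {k : ℝ} (hk : |k| < 1) (u : ℝ) :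
    HasStrictDerivAt (fun u => jacobiSd u k) (jacobiSdDeriv u k) u := by
  have hd := (jacobiDn_pos hk u).ne'
  refine ((hasStrictDerivAt_jacobiSn hk u).div (hasStrictDerivAt_jacobiDn hk u) hd).congr_deriv ?_
  have hd2 := jacobiDn_sq hk u
  simp only [jacobiSdDeriv]
  field_simp
  linear_combination jacobiCn u k * hd2

theorem continuous_jacobiSd {k : ℝ} (hk : |k| < 1) : Continuous fun u => jacobiSd u k :=
  continuous_iff_continuousAt.2 fun u => (hasStrictDerivAt_jacobiSd hk u).hasDerivAt.continuousAt

theorem hasStrictDerivAt_jacobiSdDeriv {k : ℝ} (hk : |k| < 1) (u : ℝ) :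
    HasStrictDerivAt (fun u => jacobiSdDeriv u k)
      ((2 * k ^ 2 - 1) * jacobiSd u k - 2 * k ^ 2 * (1 - k ^ 2) * jacobiSd u k ^ 3) u := by
  have hd := (jacobiDn_pos hk u).ne'
  refine ((hasStrictDerivAt_jacobiCn hk u).div ((hasStrictDerivAt_jacobiDn hk u).pow 2)
    (pow_ne_zero 2 hd)).congr_deriv ?_
  have hd2 := jacobiDn_sq hk u
  have hc2 := jacobiCn_sq u k
  simp only [jacobiSd, Pi.pow_apply, Nat.add_one_sub_one, pow_one, Nat.cast_ofNat]
  field_simp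
  linear_combination 2 * k ^ 2 * jacobiSn u k * hc2 - 2 * k ^ 2 * jacobiSn u k * hd2

theorem jacobiSdDeriv_sq {k : ℝ} (hk : |k| < 1) (u : ℝ) :
    jacobiSdDeriv u k ^ 2 =
      (1 - (1 - k ^ 2) * jacobiSd u k ^ 2) * (1 + k ^ 2 * jacobiSd u k ^ 2) := by
  have hd := (jacobiDn_pos hk u).ne'
  have hd2 := jacobiDn_sq hk u
  have hc2 := jacobiCn_sq u k
  simp only [jacobiSd, jacobiSdDeriv]
  field_simp
  linear_combination hc2 - (jacobiDn u k ^ 2 - (1 - 2 * k ^ 2) * jacobiSn u k ^ 2 +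
    (1 - k ^ 2 * jacobiSn u k ^ 2)) * hd2

theorem jacobiSd_pos {k u : ℝ} (hk : |k| < 1) (hu : u ∈ Ioo 0 (2 * ellipticK k)) :
    0 < jacobiSd u k := by
  refine div_pos (Real.sin_pos_of_pos_of_lt_pi ?_ ?_) (jacobiDn_pos hk u)
  · simpa only [jacobiAm_zero hk] using strictMono_jacobiAm hk hu.1
  · simpa only [jacobiAm_two_mul_ellipticK hk] using strictMono_jacobiAm hk hu.2

theorem jacobiSdDeriv_zero {k : ℝ} (hk : |k| < 1) : jacobiSdDeriv 0 k = 1 := by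
  simp [jacobiSdDeriv, jacobiCn, jacobiDn, jacobiSn, jacobiAm_zero hk]

theorem jacobiSdDeriv_two_mul_ellipticK {k : ℝ} (hk : |k| < 1) :
    jacobiSdDeriv (2 * ellipticK k) k = -1 := by
  simp [jacobiSdDeriv, jacobiCn, jacobiDn, jacobiSn, jacobiAm_two_mul_ellipticK hk]

theorem hasStrictDerivAt_invFunOn {f : ℝ → ℝ} {s : Set ℝ} {t f' : ℝ} (hs : s ∈ 𝓝 t)
    (hf : HasStrictDerivAt f f' t) (hf' : f' ≠ 0) (hinj : InjOn f s) :
    HasStrictDerivAt (Function.invFunOn f s) f'⁻¹ (f t) := by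
  refine hf.to_local_left_inverse hf' ?_
  filter_upwards [hs] with y hy
  exact hinj.leftInvOn_invFunOn hy

end Elliptic

/-! ### The profile curve -/

section Profile

theorem abs_one_div_sqrt_two_lt_one : |1 / √2| < 1 := by
  rw [abs_of_pos (by positivity), div_lt_one (by positivity)]
  exact Real.lt_sqrt_of_sq_lt (by norm_num)

theorem one_div_sqrt_two_sq : (1 / √2) ^ 2 = 1 / 2 := by
  rw [div_pow, Real.sq_sqrt zero_le_two, one_pow]

/-- The interval `(0, 2 K)` between two consecutive zeros of `sd(·, 1 / √2)`. -/
abbrev profileDomain : Set ℝ := Ioo 0 (2 * ellipticK (1 / √2))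

/-- The function `sd(·, 1 / √2)`. -/
abbrev sd (u : ℝ) : ℝ := jacobiSd u (1 / √2)

/-- The derivative of `sd(·, 1 / √2)`. -/
abbrev sd' (u : ℝ) : ℝ := jacobiSdDeriv u (1 / √2)

theorem sd_pos {u : ℝ} (hu : u ∈ profileDomain) : 0 < sd u :=
  jacobiSd_pos abs_one_div_sqrt_two_lt_one hu

theorem hasStrictDerivAt_sd (u : ℝ) : HasStrictDerivAt sd (sd' u) u :=
  hasStrictDerivAt_jacobiSd abs_one_div_sqrt_two_lt_one u

theorem hasStrictDerivAt_sd' (u : ℝ) : HasStrictDerivAt sd' (-(sd u ^ 3 / 2)) u := by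
  refine (hasStrictDerivAt_jacobiSdDeriv abs_one_div_sqrt_two_lt_one u).congr_deriv ?_
  rw [one_div_sqrt_two_sq]
  ring

theorem sd'_sq_add (u : ℝ) : sd' u ^ 2 + sd u ^ 4 / 4 = 1 := by
  have h := jacobiSdDeriv_sq abs_one_div_sqrt_two_lt_one u
  rw [one_div_sqrt_two_sq] at h
  linear_combination h

theorem continuous_sd' : Continuous sd' :=
  continuous_iff_continuousAt.2 fun u => (hasStrictDerivAt_sd' u).hasDerivAt.continuousAt

theorem strictAntiOn_sd' : StrictAntiOn sd' profileDomain := by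
  refine strictAntiOn_of_deriv_neg (convex_Ioo _ _) continuous_sd'.continuousOn fun u hu => ?_
  rw [interior_Ioo] at hu
  rw [(hasStrictDerivAt_sd' u).hasDerivAt.deriv]
  have := pow_pos (sd_pos hu) 3
  linarith

theorem surjOn_sd' : SurjOn sd' profileDomain (Ioo (-1) 1) := by
  have hk := abs_one_div_sqrt_two_lt_one
  have h := intermediate_value_Ioo' (by linarith [ellipticK_pos hk]) continuous_sd'.continuousOn
    (a := 0) (b := 2 * ellipticK (1 / √2))
  rwa [sd', sd', jacobiSdDeriv_zero hk, jacobiSdDeriv_two_mul_ellipticK hk] at h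

/-- The inverse of the restriction of `sd'` to `(0, 2 K)`. -/
def sdDerivInv : ℝ → ℝ := Function.invFunOn sd' profileDomain

theorem sdDerivInv_mem {σ : ℝ} (hσ : σ ∈ Ioo (-1 : ℝ) 1) : sdDerivInv σ ∈ profileDomain :=
  Function.invFunOn_mem (surjOn_sd' hσ)

theorem sd'_sdDerivInv {σ : ℝ} (hσ : σ ∈ Ioo (-1 : ℝ) 1) : sd' (sdDerivInv σ) = σ :=
  Function.invFunOn_eq (surjOn_sd' hσ)

theorem hasStrictDerivAt_sdDerivInv {σ : ℝ} (hσ : σ ∈ Ioo (-1 : ℝ) 1) :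
    HasStrictDerivAt sdDerivInv (-(sd (sdDerivInv σ) ^ 3 / 2))⁻¹ σ := by
  have hu := sdDerivInv_mem hσ
  have hpos := pow_pos (sd_pos hu) 3
  have h := hasStrictDerivAt_invFunOn (Ioo_mem_nhds hu.1 hu.2)
    (hasStrictDerivAt_sd' (sdDerivInv σ)) (by linarith) strictAntiOn_sd'.injOn
  rwa [sd'_sdDerivInv hσ] at h

theorem sd_sdDerivInv {σ r : ℝ} (hσ : σ ∈ Ioo (-1 : ℝ) 1) (hr : 0 < r)
    (h : σ ^ 2 + r ^ 4 / 4 = 1) : sd (sdDerivInv σ) = r := by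
  have hS := sd'_sq_add (sdDerivInv σ)
  rw [sd'_sdDerivInv hσ] at hS
  refine (pow_left_inj₀ (sd_pos (sdDerivInv_mem hσ)).le hr.le four_ne_zero).1 ?_
  linarith

/-- The radius of the profile curve of the hypersurface with parameter `a`. -/
def profileRadius (a t : ℝ) : ℝ := 1 / a * sd (a * t)

/-- The height of the profile curve of the hypersurface with parameter `a`. -/
def profileHeight (a t : ℝ) : ℝ := 1 / 2 * ∫ s in (0 : ℝ)..t, sd (a * s) ^ 2

theorem hasStrictDerivAt_profileRadius {a : ℝ} (ha : 0 < a) (t : ℝ) :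
    HasStrictDerivAt (profileRadius a) (sd' (a * t)) t := by
  refine (((hasStrictDerivAt_sd (a * t)).comp t
    ((hasStrictDerivAt_id t).const_mul a)).const_mul (1 / a)).congr_deriv ?_
  field_simp

theorem hasStrictDerivAt_profileHeight (a t : ℝ) :
    HasStrictDerivAt (profileHeight a) (1 / 2 * sd (a * t) ^ 2) t := by
  have hc : Continuous fun s => sd (a * s) ^ 2 :=
    ((continuous_jacobiSd abs_one_div_sqrt_two_lt_one).comp (continuous_const_mul a)).pow 2
  exact (hc.integral_hasStrictDerivAt 0 t).const_mul (1 / 2)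

/-- The height of the profile curve as a function of the derivative of its radius. -/
def heightOfSlope (a σ : ℝ) : ℝ := profileHeight a (sdDerivInv σ / a)

theorem hasDerivAt_heightOfSlope {a σ r : ℝ} (ha : 0 < a) (hr : 0 < r)
    (hσ : σ ∈ Ioo (-1 : ℝ) 1) (h : σ ^ 2 + r ^ 4 / 4 = 1) :
    HasDerivAt (heightOfSlope a) (-(1 / (a * r))) σ := by
  refine ((hasStrictDerivAt_profileHeight a (sdDerivInv σ / a)).hasDerivAt.comp σ
    ((hasStrictDerivAt_sdDerivInv hσ).hasDerivAt.div_const a)).congr_deriv ?_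
  rw [mul_div_cancel₀ _ ha.ne', sd_sdDerivInv hσ hr h]
  field_simp

end Profile

/-! ### The model hypersurface -/

section Model

/-- The domain `(0, 2 K / a)` of the arc length parameter of the profile curve. -/
abbrev arcDomain (a : ℝ) : Set ℝ := Ioo 0 (2 * ellipticK (1 / √2) / a)

theorem pos_of_mem_arcDomain {a t : ℝ} (ht : t ∈ arcDomain a) : 0 < a :=
  (div_pos_iff_of_pos_left
    (mul_pos two_pos (ellipticK_pos abs_one_div_sqrt_two_lt_one))).1 (ht.1.trans ht.2)

theorem mul_mem_profileDomain {a t : ℝ} (ht : t ∈ arcDomain a) : a * t ∈ profileDomain :=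
  have ha := pos_of_mem_arcDomain ht
  ⟨mul_pos ha ht.1, (lt_div_iff₀' ha).1 ht.2⟩

theorem profileRadius_pos {a t : ℝ} (ht : t ∈ arcDomain a) : 0 < profileRadius a t :=
  mul_pos (one_div_pos.2 (pos_of_mem_arcDomain ht)) (sd_pos (mul_mem_profileDomain ht))

theorem strictMonoOn_profileHeight (a : ℝ) :
    StrictMonoOn (profileHeight a) (Icc 0 (2 * ellipticK (1 / √2) / a)) := by
  refine strictMonoOn_of_deriv_pos (convex_Icc _ _) (fun t _ =>
    (hasStrictDerivAt_profileHeight a t).hasDerivAt.continuousAt.continuousWithinAt) fun t ht => ?_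
  rw [interior_Icc] at ht
  rw [(hasStrictDerivAt_profileHeight a t).hasDerivAt.deriv]
  have := sd_pos (mul_mem_profileDomain ht)
  positivity

theorem injOn_profileHeight (a : ℝ) : InjOn (profileHeight a) (arcDomain a) :=
  ((strictMonoOn_profileHeight a).mono Ioo_subset_Icc_self).injOn

theorem profileHeight_pos {a t : ℝ} (ht : t ∈ arcDomain a) : 0 < profileHeight a t := by
  have h := strictMonoOn_profileHeight a ⟨le_rfl, (ht.1.trans ht.2).le⟩ ⟨ht.1.le, ht.2.le⟩ ht.1
  rwa [profileHeight, intervalIntegral.integral_same, mul_zero] at h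

/-- The radius of the profile curve as a function of its height. -/
def radiusOfHeight (a z : ℝ) : ℝ :=
  profileRadius a (Function.invFunOn (profileHeight a) (arcDomain a) z)

theorem radiusOfHeight_profileHeight {a t : ℝ} (ht : t ∈ arcDomain a) :
    radiusOfHeight a (profileHeight a t) = profileRadius a t := by
  rw [radiusOfHeight, (injOn_profileHeight a).leftInvOn_invFunOn ht]

theorem differentiableAt_radiusOfHeight {a t : ℝ} (ht : t ∈ arcDomain a) :
    DifferentiableAt ℝ (radiusOfHeight a) (profileHeight a t) := by
  have hsd := sd_pos (mul_mem_profileDomain ht)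
  have hinv := hasStrictDerivAt_invFunOn (Ioo_mem_nhds ht.1 ht.2)
    (hasStrictDerivAt_profileHeight a t) (by positivity) (injOn_profileHeight a)
  exact (hasStrictDerivAt_profileRadius
    (pos_of_mem_arcDomain ht) _).hasDerivAt.differentiableAt.comp
    _ hinv.hasDerivAt.differentiableAt

variable {n : ℕ}

/-- The projection of `𝔼 (n + 1)` that forgets the last coordinate. -/
def horizontal : 𝔼 (n + 1) →L[ℝ] 𝔼 n :=
  (EuclideanSpace.equiv (Fin n) ℝ).symm.toContinuousLinearMap ∘L
    ContinuousLinearMap.pi fun i => EuclideanSpace.proj i.castSucc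

theorem horizontal_apply (q : 𝔼 (n + 1)) (i : Fin n) : horizontal q i = q i.castSucc := rfl

theorem eq_of_horizontal_eq {q q' : 𝔼 (n + 1)} (hhor : horizontal q = horizontal q')
    (hlast : q (Fin.last n) = q' (Fin.last n)) : q = q' := by
  ext i
  refine Fin.lastCases hlast (fun j => ?_) i
  rw [← horizontal_apply, hhor, horizontal_apply]

/-- The rotational hypersurface of `𝔼 (n + 1)` about the last coordinate axis generated by the
profile curve with parameter `a`. -/
def sdHypersurface (n : ℕ) (a : ℝ) : Set (𝔼 (n + 1)) :=
  {q | ∃ t ∈ arcDomain a, ‖horizontal q‖ = profileRadius a t ∧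
    q (Fin.last n) = profileHeight a t}

/-- The map `sdHypersurface n a → 𝔼 n` that keeps the direction of the horizontal part of a point
and replaces its length by the height of the point. It is injective, because the height, unlike the
radius, determines the point of the profile curve. -/
def toShell (q : 𝔼 (n + 1)) : 𝔼 n := (q (Fin.last n) / ‖horizontal q‖) • horizontal q

/-- The inverse of `toShell` on its image. -/
def ofShell (a : ℝ) (y : 𝔼 n) : 𝔼 (n + 1) :=
  WithLp.toLp 2 (Fin.snoc (fun i => radiusOfHeight a ‖y‖ / ‖y‖ * y i) ‖y‖ : Fin (n + 1) → ℝ)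

theorem horizontal_ofShell (a : ℝ) (y : 𝔼 n) :
    horizontal (ofShell a y) = (radiusOfHeight a ‖y‖ / ‖y‖) • y := by
  ext i
  simp [horizontal_apply, ofShell]

theorem ofShell_last (a : ℝ) (y : 𝔼 n) : ofShell a y (Fin.last n) = ‖y‖ := by
  simp [ofShell]

theorem norm_horizontal_pos {a : ℝ} {q : 𝔼 (n + 1)} (hq : q ∈ sdHypersurface n a) :
    0 < ‖horizontal q‖ := by
  obtain ⟨t, ht, hr, -⟩ := hq
  exact hr ▸ profileRadius_pos ht

theorem norm_toShell {a : ℝ} {q : 𝔼 (n + 1)} (hq : q ∈ sdHypersurface n a) :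
    ‖toShell q‖ = q (Fin.last n) := by
  have hpos := norm_horizontal_pos hq
  obtain ⟨t, ht, -, hh⟩ := hq
  have hlast : 0 < q (Fin.last n) := hh ▸ profileHeight_pos ht
  rw [toShell, norm_smul, Real.norm_of_nonneg (by positivity), div_mul_cancel₀ _ hpos.ne']

theorem ofShell_toShell {a : ℝ} {q : 𝔼 (n + 1)} (hq : q ∈ sdHypersurface n a) :
    ofShell a (toShell q) = q := by
  have hnorm := norm_toShell hq
  have hpos := norm_horizontal_pos hq
  refine eq_of_horizontal_eq ?_ (by rw [ofShell_last, hnorm])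
  obtain ⟨t, ht, hr, hh⟩ := hq
  have hlast : q (Fin.last n) ≠ 0 := hh ▸ (profileHeight_pos ht).ne'
  have hrad : radiusOfHeight a (q (Fin.last n)) = ‖horizontal q‖ := by
    rw [hh, radiusOfHeight_profileHeight ht, hr]
  rw [horizontal_ofShell, hnorm, hrad, toShell, smul_smul,
    div_mul_div_cancel₀ hlast, div_self hpos.ne', one_smul]

theorem contDiffAt_toShell {a : ℝ} {q : 𝔼 (n + 1)} (hq : q ∈ sdHypersurface n a) :
    ContDiffAt ℝ 1 toShell q := by
  have hpos := norm_horizontal_pos hq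
  have hhor : ContDiffAt ℝ 1 (fun q : 𝔼 (n + 1) => horizontal q) q := horizontal.contDiff.contDiffAt
  have hlast : ContDiffAt ℝ 1 (fun q : 𝔼 (n + 1) => q (Fin.last n)) q :=
    (EuclideanSpace.proj (𝕜 := ℝ) (Fin.last n)).contDiff.contDiffAt
  exact (hlast.div (hhor.norm ℝ (norm_pos_iff.1 hpos)) hpos.ne').smul hhor

theorem differentiableAt_ofShell {a : ℝ} {q : 𝔼 (n + 1)} (hq : q ∈ sdHypersurface n a) :
    DifferentiableAt ℝ (ofShell a) (toShell q) := by
  have hnorm := norm_toShell hq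
  obtain ⟨t, ht, -, hh⟩ := hq
  have hy : ‖toShell q‖ ≠ 0 := by rw [hnorm, hh]; exact (profileHeight_pos ht).ne'
  have hn : DifferentiableAt ℝ (fun y : 𝔼 n => ‖y‖) (toShell q) :=
    differentiableAt_id.norm ℝ (norm_ne_zero_iff.1 hy)
  have hr : DifferentiableAt ℝ (fun y : 𝔼 n => radiusOfHeight a ‖y‖) (toShell q) := by
    refine DifferentiableAt.comp (f := fun y : 𝔼 n => ‖y‖) (g := radiusOfHeight a) _ ?_ hn
    rw [hnorm, hh]
    exact differentiableAt_radiusOfHeight ht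
  refine differentiableAt_euclidean.2 fun i => Fin.lastCases ?_ (fun j => ?_) i
  · simpa only [ofShell_last] using hn
  · simp only [ofShell, Fin.snoc_castSucc, div_eq_mul_inv]
    exact (hr.fun_mul (hn.inv hy)).fun_mul (EuclideanSpace.proj (𝕜 := ℝ) j).differentiableAt

end Model

section RotHypersurface

/-- The point of the unit sphere of `𝔼 3` with angles `u` and `v`. -/
def spherePoint (u v : ℝ) : 𝔼 3 :=
  !₂[Real.sin u, Real.cos u * Real.sin v, Real.cos u * Real.cos v]

theorem norm_spherePoint (u v : ℝ) : ‖spherePoint u v‖ = 1 := by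
  rw [← sq_eq_sq₀ (norm_nonneg _) zero_le_one, EuclideanSpace.real_norm_sq_eq, Fin.sum_univ_three]
  change Real.sin u ^ 2 + (Real.cos u * Real.sin v) ^ 2 + (Real.cos u * Real.cos v) ^ 2 = _
  linear_combination Real.sin_sq_add_cos_sq u + Real.cos u ^ 2 * Real.sin_sq_add_cos_sq v

theorem exists_eq_norm_smul_spherePoint (y : 𝔼 3) : ∃ u v, y = ‖y‖ • spherePoint u v := by
  set w : ℂ := ⟨y 2, y 1⟩
  set z : ℂ := ⟨‖w‖, y 0⟩ with hz
  have hnorm : ‖z‖ = ‖y‖ := by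
    rw [← sq_eq_sq₀ (norm_nonneg _) (norm_nonneg _), Complex.sq_norm, Complex.normSq_apply,
      EuclideanSpace.real_norm_sq_eq, Fin.sum_univ_three, hz, ← sq, Complex.sq_norm,
      Complex.normSq_apply]
    ring
  have hcos : ‖y‖ * Real.cos z.arg = ‖w‖ := by rw [← hnorm, Complex.norm_mul_cos_arg]
  refine ⟨z.arg, w.arg, ?_⟩
  ext i
  fin_cases i
  · change y 0 = ‖y‖ * Real.sin z.arg
    rw [← hnorm, Complex.norm_mul_sin_arg]
  · change y 1 = ‖y‖ * (Real.cos z.arg * Real.sin w.arg)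
    rw [← mul_assoc, hcos, Complex.norm_mul_sin_arg]
  · change y 2 = ‖y‖ * (Real.cos z.arg * Real.cos w.arg)
    rw [← mul_assoc, hcos, Complex.norm_mul_cos_arg]

theorem horizontal_rotParam (a t u v : ℝ) :
    horizontal (n := 3) (rotParam a t u v) = profileRadius a t • spherePoint u v := by
  ext i
  fin_cases i
  · rfl
  · exact mul_assoc _ _ _
  · exact mul_assoc _ _ _

theorem rotHypersurface_eq_sdHypersurface : rotHypersurface = sdHypersurface 3 := by
  ext a q
  constructor
  · rintro ⟨t, u, v, h0, h1, rfl⟩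
    refine ⟨t, ⟨h0, h1⟩, ?_, rfl⟩
    rw [horizontal_rotParam, norm_smul, norm_spherePoint, mul_one,
      Real.norm_of_nonneg (profileRadius_pos ⟨h0, h1⟩).le]
  · rintro ⟨t, ht, hr, hh⟩
    obtain ⟨u, v, huv⟩ := exists_eq_norm_smul_spherePoint (horizontal q)
    rw [hr, ← horizontal_rotParam] at huv
    exact ⟨t, u, v, ht.1, ht.2, eq_of_horizontal_eq huv hh⟩

end RotHypersurface

/-! ### Immersions in charts -/

section Charts

theorem isLocalHomeomorph_of_comp_injective {X Y Z : Type*} [TopologicalSpace X]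
    [TopologicalSpace Y] [TopologicalSpace Z] {f : X → Y} {g : Y → Z}
    (hgf : IsLocalHomeomorph (g ∘ f)) (hg : Function.Injective g) (hgc : Continuous g)
    (hf : Continuous f) : IsLocalHomeomorph f := by
  rw [isLocalHomeomorph_iff_isOpenEmbedding_restrict] at hgf ⊢
  intro p
  obtain ⟨U, hU, hemb⟩ := hgf p
  have hcomp : U.domRestrict (g ∘ f) = g ∘ U.domRestrict f := rfl
  rw [hcomp] at hemb
  refine ⟨U, hU, .of_comp (hf.comp continuous_subtype_val) hgc hemb.isEmbedding, ?_⟩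
  rw [← hg.preimage_image (range (U.domRestrict f)), ← range_comp]
  exact hemb.isOpen_range.preimage hgc

variable {n m : ℕ} {M : Type*} [TopologicalSpace M] [ChartedSpace (𝔼 n) M]
  {F : Type*} [NormedAddCommGroup F] [NormedSpace ℝ F] {p : M}
  {φ : OpenPartialHomeomorph M (𝔼 n)}

theorem isLocalHomeomorph_of_injective_fderiv {f : M → 𝔼 n}
    (hf : ∀ p, ContDiffAt ℝ 1 (f ∘ (chartAt (𝔼 n) p).symm) (chartAt (𝔼 n) p p))
    (hinj : ∀ p, Function.Injective
      (fderiv ℝ (f ∘ (chartAt (𝔼 n) p).symm) (chartAt (𝔼 n) p p))) :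
    IsLocalHomeomorph f := by
  refine IsLocalHomeomorph.mk _ fun p => ?_
  let A : 𝔼 n ≃L[ℝ] 𝔼 n :=
    (LinearEquiv.ofInjectiveEndo (fderiv ℝ (f ∘ (chartAt (𝔼 n) p).symm)
      (chartAt (𝔼 n) p p)).toLinearMap (hinj p)).toContinuousLinearEquiv
  have hA : HasStrictFDerivAt (f ∘ (chartAt (𝔼 n) p).symm) (A : 𝔼 n →L[ℝ] 𝔼 n)
      (chartAt (𝔼 n) p p) := (hf p).hasStrictFDerivAt one_ne_zero
  refine ⟨(chartAt (𝔼 n) p).trans (hA.toOpenPartialHomeomorph _), ?_, fun z hz => ?_⟩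
  · rw [OpenPartialHomeomorph.trans_source]
    exact ⟨mem_chart_source _ p, hA.mem_toOpenPartialHomeomorph_source⟩
  · rw [OpenPartialHomeomorph.trans_source] at hz
    exact (congrArg f ((chartAt (𝔼 n) p).left_inv hz.1)).symm

variable [IsManifold 𝓘(ℝ, 𝔼 n) ∞ M]

theorem hasMFDerivAt_of_eventuallyEq_comp_chart (hφ : φ ∈ atlas (𝔼 n) M) (hp : p ∈ φ.source)
    {f : M → F} {g : 𝔼 n → F} (hg : DifferentiableAt ℝ g (φ p)) (hf : f =ᶠ[𝓝 p] g ∘ φ) :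
    HasMFDerivAt 𝓘(ℝ, 𝔼 n) 𝓘(ℝ, F) f p
      ((fderiv ℝ g (φ p)).comp (mfderiv 𝓘(ℝ, 𝔼 n) 𝓘(ℝ, 𝔼 n) φ p)) :=
  (hg.hasFDerivAt.hasMFDerivAt.comp p
    (mdifferentiableAt_atlas (I := 𝓘(ℝ, 𝔼 n)) hφ hp).hasMFDerivAt).congr_of_eventuallyEq hf

theorem mfderiv_chart_bijective (hφ : φ ∈ atlas (𝔼 n) M) (hp : p ∈ φ.source) :
    Function.Bijective (mfderiv 𝓘(ℝ, 𝔼 n) 𝓘(ℝ, 𝔼 n) φ p) :=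
  (mdifferentiable_of_mem_atlas (I := 𝓘(ℝ, 𝔼 n)) hφ).mfderiv_bijective hp

namespace IsSmoothImmersion

variable {x : M → 𝔼 m}

theorem contDiffOn_comp_symm (hx : IsSmoothImmersion (n := n) x) (hφ : φ ∈ atlas (𝔼 n) M) :
    ContDiffOn ℝ ∞ (x ∘ φ.symm) φ.target := by
  rw [← contMDiffOn_iff_contDiffOn]
  exact hx.1.comp_contMDiffOn
    (contMDiffOn_symm_of_mem_maximalAtlas (IsManifold.subset_maximalAtlas hφ))

theorem contDiffAt_comp_symm (hx : IsSmoothImmersion (n := n) x) (hφ : φ ∈ atlas (𝔼 n) M)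
    (hp : p ∈ φ.source) : ContDiffAt ℝ ∞ (x ∘ φ.symm) (φ p) :=
  (hx.contDiffOn_comp_symm hφ).contDiffAt (φ.open_target.mem_nhds (φ.map_source hp))

theorem mfderiv_eq_comp_mfderiv_chart (hx : IsSmoothImmersion (n := n) x)
    (hφ : φ ∈ atlas (𝔼 n) M) (hp : p ∈ φ.source) :
    mfderiv 𝓘(ℝ, 𝔼 n) 𝓘(ℝ, 𝔼 m) x p =
      (fderiv ℝ (x ∘ φ.symm) (φ p)).comp (mfderiv 𝓘(ℝ, 𝔼 n) 𝓘(ℝ, 𝔼 n) φ p) := by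
  refine (hasMFDerivAt_of_eventuallyEq_comp_chart hφ hp
    ((hx.contDiffAt_comp_symm hφ hp).differentiableAt (by simp)) ?_).mfderiv
  filter_upwards [φ.open_source.mem_nhds hp] with z hz
  exact (congrArg x (φ.left_inv hz)).symm

theorem fderiv_comp_symm_injective (hx : IsSmoothImmersion (n := n) x)
    (hφ : φ ∈ atlas (𝔼 n) M) {y : 𝔼 n} (hy : y ∈ φ.target) :
    Function.Injective (fderiv ℝ (x ∘ φ.symm) y) := by
  have hp := φ.map_target hy
  have hinj := hx.2 (φ.symm y)
  rw [hx.mfderiv_eq_comp_mfderiv_chart hφ hp, φ.right_inv hy] at hinj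
  exact (Function.Injective.of_comp_iff' _ (mfderiv_chart_bijective hφ hp)).1 hinj

theorem isLocalHomeomorph_of_leftInverse (hx : IsSmoothImmersion (n := n) x) {S : Set (𝔼 m)}
    (hS : ∀ p, x p ∈ S) {g : 𝔼 m → 𝔼 n} {r : 𝔼 n → 𝔼 m} (hg : ∀ q ∈ S, ContDiffAt ℝ 1 g q)
    (hr : ∀ q ∈ S, DifferentiableAt ℝ r (g q)) (hrg : LeftInvOn r g S) :
    IsLocalHomeomorph fun p => (⟨x p, hS p⟩ : S) := by
  refine isLocalHomeomorph_of_comp_injective (g := S.domRestrict g) ?_ hrg.injOn.injective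
    (continuousOn_iff_continuous_domRestrict.1 fun q hq =>
      (hg q hq).continuousAt.continuousWithinAt)
    (hx.1.continuous.subtype_mk _)
  have hsmooth : ∀ p, ContDiffAt ℝ 1 (g ∘ (x ∘ (chartAt (𝔼 n) p).symm)) (chartAt (𝔼 n) p p) :=
    fun p => ContDiffAt.comp _ (hg _ (hS _)) ((hx.contDiffAt_comp_symm
      (chart_mem_atlas _ p) (mem_chart_source _ p)).of_le (by simp))
  refine isLocalHomeomorph_of_injective_fderiv hsmooth fun p => ?_
  set X := x ∘ (chartAt (𝔼 n) p).symm with hX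
  have hrX : r ∘ (g ∘ X) = X := funext fun _ => hrg (hS _)
  have hfderiv := fderiv_comp (f := g ∘ X) (g := r) (chartAt (𝔼 n) p p) (hr _ (hS _))
    ((hsmooth p).differentiableAt one_ne_zero)
  have hinj := hx.fderiv_comp_symm_injective (chart_mem_atlas _ p)
    ((chartAt (𝔼 n) p).map_source (mem_chart_source _ p))
  rw [← hX, ← hrX, hfderiv] at hinj
  exact Function.Injective.of_comp hinj

end IsSmoothImmersion

theorem isLocalHomeomorph_sdHypersurface {x : M → 𝔼 (n + 1)} (hx : IsSmoothImmersion (n := n) x)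
    {a : ℝ} (h : ∀ p, x p ∈ sdHypersurface n a) :
    IsLocalHomeomorph fun p => (⟨x p, h p⟩ : sdHypersurface n a) :=
  hx.isLocalHomeomorph_of_leftInverse h (fun _ => contDiffAt_toShell)
    (fun _ => differentiableAt_ofShell) fun _ => ofShell_toShell

end Charts

/-! ### Second derivatives -/

section SecondDerivative

variable {E F : Type*} [NormedAddCommGroup E] [NormedSpace ℝ E] {y : E}

section

variable [NormedAddCommGroup F] [NormedSpace ℝ F] {f : E → F}

/-- The second derivative of `f` at `y`, as a bilinear map. -/
def hess (f : E → F) (y : E) : E →L[ℝ] E →L[ℝ] F := fderiv ℝ (fderiv ℝ f) y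

theorem fderiv_fderiv_apply (hf : ContDiffAt ℝ ∞ f y) (v w : E) :
    fderiv ℝ (fun z => fderiv ℝ f z w) y v = hess f y v w := by
  have hdiff : DifferentiableAt ℝ (fderiv ℝ f) y :=
    (hf.fderiv_right (m := ∞) (by simp)).differentiableAt (by simp)
  rw [fderiv_clm_apply hdiff (differentiableAt_const w)]
  simp [hess]

theorem hess_symm (hf : ContDiffAt ℝ ∞ f y) (v w : E) : hess f y v w = hess f y w v :=
  have two_le : (2 : WithTop ℕ∞) ≤ ∞ := WithTop.coe_le_coe.2 (le_top : (2 : ℕ∞) ≤ ⊤)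
  (hf.isSymmSndFDerivAt (by simpa using two_le)).eq v w

theorem contDiffAt_fderiv_apply (hf : ContDiffAt ℝ ∞ f y) (w : E) :
    ContDiffAt ℝ ∞ (fun z => fderiv ℝ f z w) y :=
  (hf.fderiv_right (by simp)).clm_apply contDiffAt_const

theorem contDiffAt_hess (hf : ContDiffAt ℝ ∞ f y) : ContDiffAt ℝ ∞ (hess f) y :=
  (hf.fderiv_right (by simp) : ContDiffAt ℝ ∞ (fderiv ℝ f) y).fderiv_right (by simp)

end

theorem inner_fderiv_of_inner_eq_const [NormedAddCommGroup F] [InnerProductSpace ℝ F]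
    {f g : E → F} (hf : DifferentiableAt ℝ f y) (hg : DifferentiableAt ℝ g y) {c : ℝ}
    (h : ∀ᶠ z in 𝓝 y, ⟪f z, g z⟫ = c) (v : E) :
    ⟪fderiv ℝ f y v, g y⟫ = -⟪f y, fderiv ℝ g y v⟫ := by
  have hprod := fderiv_inner_apply ℝ hf hg v
  rw [Filter.EventuallyEq.fderiv_eq (f := fun _ => c) h, fderiv_fun_const, Pi.zero_apply,
    zero_apply] at hprod
  linarith

end SecondDerivative

/-! ### Left inverses of injective linear maps -/

section LeftInverse

variable {E F : Type*} [NormedAddCommGroup E] [InnerProductSpace ℝ E] [FiniteDimensional ℝ E]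
  [NormedAddCommGroup F] [InnerProductSpace ℝ F] [FiniteDimensional ℝ F] {D : E →L[ℝ] F}

/-- The Moore–Penrose left inverse `(D† D)⁻¹ D†` of an injective linear map `D`. It vanishes on the
orthogonal complement of the range and depends smoothly on `D`. -/
def leftInv (D : E →L[ℝ] F) : F →L[ℝ] E :=
  (D.adjoint ∘L D).inverse ∘L D.adjoint

theorem exists_equiv_eq_adjoint_comp (hD : Function.Injective D) :
    ∃ e : E ≃L[ℝ] E, (e : E →L[ℝ] E) = D.adjoint ∘L D := by
  have hinj : Function.Injective (D.adjoint ∘L D) := by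
    refine (injective_iff_map_eq_zero _).2 fun v hv => hD ?_
    rw [map_zero, ← inner_self_eq_zero (𝕜 := ℝ), ← ContinuousLinearMap.adjoint_inner_left]
    exact (congrArg (⟪·, v⟫) hv).trans (inner_zero_left v)
  exact ⟨(LinearEquiv.ofInjectiveEndo (D.adjoint ∘L D).toLinearMap hinj).toContinuousLinearEquiv,
    rfl⟩

theorem leftInv_map (hD : Function.Injective D) (v : E) : leftInv D (D v) = v := by
  obtain ⟨e, he⟩ := exists_equiv_eq_adjoint_comp hD
  change (D.adjoint ∘L D).inverse ((D.adjoint ∘L D) v) = v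
  rw [← he, ContinuousLinearMap.inverse_equiv]
  exact e.symm_apply_apply v

theorem leftInv_eq_zero {z : F} (hz : ∀ v, ⟪D v, z⟫ = 0) : leftInv D z = 0 := by
  have hadj : D.adjoint z = 0 := ext_inner_left ℝ fun v => by
    rw [ContinuousLinearMap.adjoint_inner_right, hz, inner_zero_right]
  rw [leftInv, ContinuousLinearMap.comp_apply, hadj, map_zero]

theorem map_leftInv (hD : Function.Injective D) (z : F) :
    D (leftInv D z) = D.range.starProjection z := by
  obtain ⟨v, hv⟩ : D.range.starProjection z ∈ D.range := Submodule.starProjection_apply_mem _ z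
  have hperp : leftInv D (z - D.range.starProjection z) = 0 := leftInv_eq_zero fun w =>
    Submodule.inner_right_of_mem_orthogonal (LinearMap.mem_range_self D.toLinearMap w)
      (Submodule.sub_starProjection_mem_orthogonal z)
  have hv' : D v = D.range.starProjection z := hv
  rw [map_sub, ← hv', leftInv_map hD, sub_eq_zero] at hperp
  rw [hperp, hv']

theorem contDiffAt_leftInv (hD : Function.Injective D) :
    ContDiffAt ℝ ∞ (leftInv : (E →L[ℝ] F) → F →L[ℝ] E) D := by
  let adj : (E →L[ℝ] F) →ₗ[ℝ] F →L[ℝ] E :=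
    { toFun := fun A => A.adjoint
      map_add' := map_add _
      map_smul' := fun c A => by simp }
  have hadj : ContDiff ℝ ∞ fun A : E →L[ℝ] F => A.adjoint :=
    adj.toContinuousLinearMap.contDiff
  obtain ⟨e, he⟩ := exists_equiv_eq_adjoint_comp hD
  have hinv : ContDiffAt ℝ ∞ (ContinuousLinearMap.inverse : (E →L[ℝ] E) → _)
      (D.adjoint ∘L D) := by
    rw [← he]
    exact contDiffAt_map_inverse e
  have hcomp : ContDiffAt ℝ ∞ (fun A : E →L[ℝ] F => A.adjoint ∘L A) D :=
    (hadj.clm_comp contDiff_id).contDiffAt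
  exact (ContDiffAt.comp (f := fun A => A.adjoint ∘L A) D hinv hcomp).clm_comp hadj.contDiffAt

end LeftInverse

/-! ### The Gauss equation -/

section Gauss

theorem sum_smul_coordVec {n : ℕ} (v : 𝔼 n) : ∑ i, v i • coordVec i = v := by
  simpa [coordVec] using (EuclideanSpace.basisFun (Fin n) ℝ).sum_repr v

theorem map_eq_sum_coordVec {n : ℕ} {F : Type*} [NormedAddCommGroup F] [NormedSpace ℝ F]
    (A : 𝔼 n →L[ℝ] F) (v : 𝔼 n) : A v = ∑ i, v i • A (coordVec i) := by
  conv_lhs => rw [← sum_smul_coordVec v]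
  simp only [map_sum, map_smul]

variable {n m : ℕ} {X : 𝔼 n → 𝔼 m} {U : Set (𝔼 n)} {y : 𝔼 n}

theorem gram_eq (X : 𝔼 n → 𝔼 m) (y : 𝔼 n) (i j : Fin n) :
    gram X y i j = ⟪fderiv ℝ X y (coordVec i), fderiv ℝ X y (coordVec j)⟫ := rfl

theorem sum_gram_mul (X : 𝔼 n → 𝔼 m) (y c z : 𝔼 n) :
    ∑ k, ∑ l, z l * (c k * gram X y k l) = ⟪fderiv ℝ X y c, fderiv ℝ X y z⟫ := by
  rw [map_eq_sum_coordVec (fderiv ℝ X y) c, map_eq_sum_coordVec (fderiv ℝ X y) z, sum_inner]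
  simp only [inner_sum, real_inner_smul_left, real_inner_smul_right, gram_eq]

theorem gram_mulVec (X : 𝔼 n → 𝔼 m) (y c : 𝔼 n) (l : Fin n) :
    (gram X y).mulVec c l = ⟪fderiv ℝ X y c, fderiv ℝ X y (coordVec l)⟫ := by
  rw [map_eq_sum_coordVec (fderiv ℝ X y) c, sum_inner, Matrix.mulVec, dotProduct]
  refine Finset.sum_congr rfl fun k _ => ?_
  rw [gram_eq, real_inner_smul_left, real_inner_comm, mul_comm]

theorem isUnit_det_gram (h : Function.Injective (fderiv ℝ X y)) : IsUnit (gram X y).det := by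
  rw [← Matrix.isUnit_iff_isUnit_det, ← Matrix.mulVec_injective_iff_isUnit]
  refine (injective_iff_map_eq_zero (Matrix.mulVecLin (gram X y))).2 fun c hc => ?_
  have hself : ⟪fderiv ℝ X y (WithLp.toLp 2 c), fderiv ℝ X y (WithLp.toLp 2 c)⟫ = 0 := by
    nth_rewrite 2 [map_eq_sum_coordVec (fderiv ℝ X y) (WithLp.toLp 2 c)]
    rw [inner_sum]
    refine Finset.sum_eq_zero fun l _ => ?_
    rw [real_inner_smul_right, ← gram_mulVec, show (gram X y).mulVec c l = 0 from congrFun hc l,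
      mul_zero]
  exact congrArg WithLp.ofLp (h ((inner_self_eq_zero.1 hself).trans (map_zero _).symm))

theorem pderiv_gram (hX : ContDiffAt ℝ ∞ X y) (i j l : Fin n) :
    pderiv i (fun z => gram X z j l) y =
      ⟪fderiv ℝ X y (coordVec j), hess X y (coordVec i) (coordVec l)⟫
        + ⟪hess X y (coordVec i) (coordVec j), fderiv ℝ X y (coordVec l)⟫ := by
  have hdiff : ∀ w, DifferentiableAt ℝ (fun z => fderiv ℝ X z w) y := fun w =>
    (contDiffAt_fderiv_apply hX w).differentiableAt (by simp)
  simp only [pderiv, gram_eq]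
  rw [fderiv_inner_apply ℝ (hdiff _) (hdiff _), fderiv_fderiv_apply hX, fderiv_fderiv_apply hX]

/-- `X` restricts to a smooth immersion of the open set `U`. -/
structure IsImmersionOn (X : 𝔼 n → 𝔼 m) (U : Set (𝔼 n)) : Prop where
  isOpen : IsOpen U
  contDiffAt : ∀ y ∈ U, ContDiffAt ℝ ∞ X y
  injective : ∀ y ∈ U, Function.Injective (fderiv ℝ X y)

/-- The covariant derivative `∇_v w` of the constant vector field `w`, that is, the tangential part
of `∂_v ∂_w X`, written in the coordinates of the parameter space. -/
def covDeriv (X : 𝔼 n → 𝔼 m) (v w y : 𝔼 n) : 𝔼 n := leftInv (fderiv ℝ X y) (hess X y v w)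

theorem hess_eq_add (hX : ContDiffAt ℝ ∞ X y) (hinj : Function.Injective (fderiv ℝ X y))
    (v w : 𝔼 n) : hess X y v w = fderiv ℝ X y (covDeriv X v w y) + secondFF X y v w := by
  rw [covDeriv, secondFF, map_leftInv hinj, fderiv_fderiv_apply hX,
    Submodule.starProjection_add_starProjection_orthogonal]

theorem inner_secondFF_fderiv (X : 𝔼 n → 𝔼 m) (y v w u : 𝔼 n) :
    ⟪secondFF X y v w, fderiv ℝ X y u⟫ = 0 :=
  Submodule.inner_left_of_mem_orthogonal (LinearMap.mem_range_self (fderiv ℝ X y).toLinearMap u)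
    (Submodule.starProjection_apply_mem _ _)

theorem inner_fderiv_covDeriv (hX : ContDiffAt ℝ ∞ X y)
    (hinj : Function.Injective (fderiv ℝ X y)) (v w u : 𝔼 n) :
    ⟪fderiv ℝ X y (covDeriv X v w y), fderiv ℝ X y u⟫ = ⟪hess X y v w, fderiv ℝ X y u⟫ := by
  rw [hess_eq_add hX hinj v w, inner_add_left, inner_secondFF_fderiv, add_zero]

theorem christoffel_eq (hX : ContDiffAt ℝ ∞ X y) (hinj : Function.Injective (fderiv ℝ X y))
    (k i j : Fin n) :
    christoffel X k i j y = covDeriv X (coordVec i) (coordVec j) y k := by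
  have hkoszul : ∀ l, pderiv i (fun z => gram X z j l) y + pderiv j (fun z => gram X z i l) y
      - pderiv l (fun z => gram X z i j) y
      = 2 * (gram X y).mulVec (covDeriv X (coordVec i) (coordVec j) y) l := fun l => by
    rw [gram_mulVec, inner_fderiv_covDeriv hX hinj]
    simp only [pderiv_gram hX, hess_symm hX (coordVec l), hess_symm hX (coordVec j) (coordVec i),
      real_inner_comm (hess X y _ _)]
    ring
  calc christoffel X k i j y
      = (gram X y)⁻¹.mulVec
          ((gram X y).mulVec (covDeriv X (coordVec i) (coordVec j) y)) k := by
        simp only [christoffel, hkoszul, Matrix.mulVec, dotProduct, Finset.mul_sum]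
        exact Finset.sum_congr rfl fun l _ => by ring_nf
    _ = _ := by
        rw [Matrix.mulVec_mulVec, Matrix.nonsing_inv_mul _ (isUnit_det_gram hinj),
          Matrix.one_mulVec]

theorem secondFF_sum_left (hX : ContDiffAt ℝ ∞ X y) (v w : 𝔼 n) :
    secondFF X y v w = ∑ i, v i • secondFF X y (coordVec i) w := by
  simp only [secondFF, fderiv_fderiv_apply hX]
  rw [map_eq_sum_coordVec (hess X y) v, sum_apply]
  simp only [smul_apply, map_sum, map_smul]

theorem secondFF_symm (hX : ContDiffAt ℝ ∞ X y) (v w : 𝔼 n) :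
    secondFF X y v w = secondFF X y w v := by
  simp only [secondFF, fderiv_fderiv_apply hX, hess_symm hX v w]

theorem secondFF_sum_right (hX : ContDiffAt ℝ ∞ X y) (v w : 𝔼 n) :
    secondFF X y v w = ∑ i, w i • secondFF X y v (coordVec i) := by
  simp only [secondFF_symm hX v, ← secondFF_sum_left hX w v]

namespace IsImmersionOn

theorem contDiffAt_leftInv_fderiv (h : IsImmersionOn X U) (hy : y ∈ U) :
    ContDiffAt ℝ ∞ (fun z => leftInv (fderiv ℝ X z)) y :=
  ContDiffAt.comp y (contDiffAt_leftInv (h.injective y hy))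
    ((h.contDiffAt y hy).fderiv_right (by simp))

theorem contDiffAt_covDeriv (h : IsImmersionOn X U) (hy : y ∈ U) (v w : 𝔼 n) :
    ContDiffAt ℝ ∞ (covDeriv X v w) y :=
  (h.contDiffAt_leftInv_fderiv hy).clm_apply
    (((contDiffAt_hess (h.contDiffAt y hy)).clm_apply contDiffAt_const).clm_apply contDiffAt_const)

theorem differentiableAt_secondFF (h : IsImmersionOn X U) (hy : y ∈ U) (v w : 𝔼 n) :
    DifferentiableAt ℝ (fun z => secondFF X z v w) y := by
  have hX := h.contDiffAt y hy
  have hsmooth : ContDiffAt ℝ ∞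
      (fun z => hess X z v w - fderiv ℝ X z (covDeriv X v w z)) y :=
    (((contDiffAt_hess hX).clm_apply contDiffAt_const).clm_apply contDiffAt_const).sub
      ((hX.fderiv_right (by simp)).clm_apply (h.contDiffAt_covDeriv hy v w))
  refine (hsmooth.differentiableAt (by simp)).congr_of_eventuallyEq ?_
  filter_upwards [h.isOpen.mem_nhds hy] with z hz
  exact eq_sub_of_add_eq' (hess_eq_add (h.contDiffAt z hz) (h.injective z hz) v w).symm

/-- The vector `R(u, v) w = ∇_u ∇_v w - ∇_v ∇_u w` for constant vector fields `u`, `v`, `w`, in the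
coordinates of the parameter space. -/
def curvatureVec (X : 𝔼 n → 𝔼 m) (u v w y : 𝔼 n) : 𝔼 n :=
  (fderiv ℝ (covDeriv X v w) y u + covDeriv X u (covDeriv X v w y) y)
    - (fderiv ℝ (covDeriv X u w) y v + covDeriv X v (covDeriv X u w y) y)

theorem riemann_eq (h : IsImmersionOn X U) (hy : y ∈ U) (l k i j : Fin n) :
    riemann X l k i j y = curvatureVec X (coordVec i) (coordVec j) (coordVec k) y l := by
  have hpderiv : ∀ i j, pderiv i (christoffel X l j k) y
      = fderiv ℝ (covDeriv X (coordVec j) (coordVec k)) y (coordVec i) l := fun i j => by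
    have hchr : christoffel X l j k =ᶠ[𝓝 y]
        EuclideanSpace.proj (𝕜 := ℝ) l ∘ covDeriv X (coordVec j) (coordVec k) := by
      filter_upwards [h.isOpen.mem_nhds hy] with z hz
      exact christoffel_eq (h.contDiffAt z hz) (h.injective z hz) l j k
    have hΓ := (h.contDiffAt_covDeriv hy (coordVec j) (coordVec k)).differentiableAt (by simp)
    rw [pderiv, hchr.fderiv_eq,
      ((EuclideanSpace.proj (𝕜 := ℝ) l).hasFDerivAt.comp y hΓ.hasFDerivAt).fderiv]
    rfl
  have hsum : ∀ i v, covDeriv X (coordVec i) v y l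
      = ∑ p, v p * covDeriv X (coordVec i) (coordVec p) y l := fun i v => by
    have := congrArg (· l) (map_eq_sum_coordVec
      (leftInv (fderiv ℝ X y) ∘L hess X y (coordVec i)) v)
    simpa [covDeriv] using this
  simp only [riemann, hpderiv, christoffel_eq (h.contDiffAt y hy) (h.injective y hy),
    Finset.sum_sub_distrib, curvatureVec, PiLp.sub_apply, PiLp.add_apply]
  rw [hsum i (covDeriv X _ _ y), hsum j (covDeriv X _ _ y)]
  simp only [mul_comm]
  ring

theorem inner_fderiv_hess (h : IsImmersionOn X U) (hy : y ∈ U) (u v w z : 𝔼 n) :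
    ⟪fderiv ℝ (fun q => hess X q v w) y u, fderiv ℝ X y z⟫
      = ⟪fderiv ℝ X y (fderiv ℝ (covDeriv X v w) y u + covDeriv X u (covDeriv X v w y) y),
          fderiv ℝ X y z⟫ - ⟪secondFF X y v w, secondFF X y u z⟫ := by
  have hX := h.contDiffAt y hy
  have hinj := h.injective y hy
  have hΓ := (h.contDiffAt_covDeriv hy v w).differentiableAt (by simp)
  have hdX : DifferentiableAt ℝ (fderiv ℝ X) y :=
    (hX.fderiv_right (m := ∞) (by simp)).differentiableAt (by simp)
  have hsplit : (fun q => hess X q v w) =ᶠ[𝓝 y]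
      fun q => fderiv ℝ X q (covDeriv X v w q) + secondFF X q v w := by
    filter_upwards [h.isOpen.mem_nhds hy] with q hq
    exact hess_eq_add (h.contDiffAt q hq) (h.injective q hq) v w
  have hderiv : fderiv ℝ (fun q => hess X q v w) y u
      = fderiv ℝ X y (fderiv ℝ (covDeriv X v w) y u) + hess X y u (covDeriv X v w y)
        + fderiv ℝ (fun q => secondFF X q v w) y u := by
    rw [hsplit.fderiv_eq, fderiv_fun_add (hdX.clm_apply hΓ) (h.differentiableAt_secondFF hy v w),
      fderiv_clm_apply hdX hΓ]
    rfl
  have hnormal : ⟪fderiv ℝ (fun q => secondFF X q v w) y u, fderiv ℝ X y z⟫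
      = -⟪secondFF X y v w, secondFF X y u z⟫ := by
    rw [inner_fderiv_of_inner_eq_const (h.differentiableAt_secondFF hy v w)
      ((contDiffAt_fderiv_apply hX z).differentiableAt (by simp))
      (.of_forall fun q => inner_secondFF_fderiv X q v w z), fderiv_fderiv_apply hX,
      hess_eq_add hX hinj u z, inner_add_right, inner_secondFF_fderiv, zero_add]
  rw [hderiv, inner_add_left, inner_add_left, hnormal, map_add, inner_add_left,
    inner_fderiv_covDeriv hX hinj]
  ring

theorem inner_curvatureVec (h : IsImmersionOn X U) (hy : y ∈ U) (u v w z : 𝔼 n) :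
    ⟪fderiv ℝ X y (curvatureVec X u v w y), fderiv ℝ X y z⟫
      = ⟪secondFF X y v w, secondFF X y u z⟫ - ⟪secondFF X y u w, secondFF X y v z⟫ := by
  have hcomm : fderiv ℝ (fun q => hess X q v w) y u = fderiv ℝ (fun q => hess X q u w) y v := by
    have hthird : ∀ a b, fderiv ℝ (fun q => hess X q a w) y b
        = hess (fun q => fderiv ℝ X q w) y b a := fun a b => by
      rw [← fderiv_fderiv_apply (contDiffAt_fderiv_apply (h.contDiffAt y hy) w)]
      refine congrArg (fun A : 𝔼 n →L[ℝ] 𝔼 m => A b) (Filter.EventuallyEq.fderiv_eq ?_)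
      filter_upwards [h.isOpen.mem_nhds hy] with q hq
      exact (fderiv_fderiv_apply (h.contDiffAt q hq) a w).symm
    rw [hthird, hthird, hess_symm (contDiffAt_fderiv_apply (h.contDiffAt y hy) w)]
  have huv := h.inner_fderiv_hess hy u v w z
  have hvu := h.inner_fderiv_hess hy v u w z
  rw [hcomm] at huv
  rw [curvatureVec, map_sub, inner_sub_left]
  linarith

theorem curvature_eq (h : IsImmersionOn X U) (hy : y ∈ U) (u v w z : 𝔼 n) :
    curvature X y u v w z
      = ⟪secondFF X y v w, secondFF X y u z⟫ - ⟪secondFF X y u w, secondFF X y v z⟫ := by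
  have hX := h.contDiffAt y hy
  have hcoord : ∀ i j k,
      ∑ l, ∑ q, u i * v j * w k * z q * riemann X l k i j y * gram X y l q
        = u i * (v j * (w k *
          (⟪secondFF X y (coordVec j) (coordVec k), secondFF X y (coordVec i) z⟫
            - ⟪secondFF X y (coordVec i) (coordVec k), secondFF X y (coordVec j) z⟫))) :=
    fun i j k => by
      rw [← h.inner_curvatureVec hy, ← sum_gram_mul]
      simp only [h.riemann_eq hy, Finset.mul_sum]
      exact Finset.sum_congr rfl fun l _ => Finset.sum_congr rfl fun q _ => by ring
  have hw : ∀ a b, ⟪secondFF X y a w, b⟫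
      = ∑ k, w k * ⟪secondFF X y a (coordVec k), b⟫ := fun a b => by
    rw [secondFF_sum_right hX a w]
    simp only [sum_inner, real_inner_smul_left]
  have hv : ⟪secondFF X y v w, secondFF X y u z⟫ = ∑ i, u i * ∑ j, v j *
      ⟪secondFF X y (coordVec j) w, secondFF X y (coordVec i) z⟫ := by
    rw [secondFF_sum_left hX v w, secondFF_sum_left hX u z]
    simp only [inner_sum, sum_inner, real_inner_smul_left, real_inner_smul_right, Finset.mul_sum]
  have hu : ⟪secondFF X y u w, secondFF X y v z⟫ = ∑ i, u i * ∑ j, v j *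
      ⟪secondFF X y (coordVec i) w, secondFF X y (coordVec j) z⟫ := by
    rw [secondFF_sum_left hX u w, secondFF_sum_left hX v z, sum_inner]
    simp only [inner_sum, real_inner_smul_left, real_inner_smul_right, Finset.mul_sum]
    exact Finset.sum_congr rfl fun i _ => Finset.sum_congr rfl fun j _ => mul_left_comm _ _ _
  simp only [curvature, hcoord, hv, hu, hw, Finset.mul_sum, mul_sub, Finset.sum_sub_distrib]

end IsImmersionOn

end Gauss

/-! ### Hypersurfaces with a unit normal field -/

section UnitNormal

theorem exists_norm_map_eq_one_map_eq_zero {E F G : Type*} [AddCommGroup E] [Module ℝ E]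
    [FiniteDimensional ℝ E] [NormedAddCommGroup F] [NormedSpace ℝ F] [AddCommGroup G] [Module ℝ G]
    [FiniteDimensional ℝ G] {D : E →ₗ[ℝ] F} (hD : Function.Injective D) (A : E →ₗ[ℝ] G)
    (hfin : Module.finrank ℝ G < Module.finrank ℝ E) : ∃ u, ‖D u‖ = 1 ∧ A u = 0 := by
  obtain ⟨u, hu, hu0⟩ :=
    Submodule.exists_mem_ne_zero_of_ne_bot (LinearMap.ker_ne_bot_of_finrank_lt (f := A) hfin)
  have hDu : D u ≠ 0 := fun h => hu0 (hD (h.trans (map_zero D).symm))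
  refine ⟨‖D u‖⁻¹ • u, ?_, ?_⟩
  · rw [map_smul]
    exact norm_smul_inv_norm hDu
  · rw [map_smul, LinearMap.mem_ker.1 hu, smul_zero]

variable {E F : Type*} [NormedAddCommGroup E] [InnerProductSpace ℝ E] [NormedAddCommGroup F]
  [InnerProductSpace ℝ F] {D : E →L[ℝ] F} {ν : F}

/-- `ν` is a unit normal vector of the hyperplane `D(E)`. -/
structure IsUnitNormal (D : E →L[ℝ] F) (ν : F) : Prop where
  norm_eq : ‖ν‖ = 1
  range_eq : D.range = (ℝ ∙ ν)ᗮ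

theorem isUnitNormal_of_inner_eq_zero [FiniteDimensional ℝ F]
    (hfin : Module.finrank ℝ F = Module.finrank ℝ E + 1)
    (hD : Function.Injective D) (hν : ‖ν‖ = 1) (h : ∀ v, ⟪D v, ν⟫ = 0) : IsUnitNormal D ν := by
  refine ⟨hν, Submodule.eq_of_le_of_finrank_eq ?_ ?_⟩
  · rintro _ ⟨v, rfl⟩
    exact Submodule.mem_orthogonal_singleton_iff_inner_left.2 (h v)
  · have : Fact (Module.finrank ℝ F = Module.finrank ℝ E + 1) := ⟨hfin⟩
    have hν0 : ν ≠ 0 := norm_ne_zero_iff.1 (by rw [hν]; exact one_ne_zero)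
    rw [Submodule.finrank_orthogonal_span_singleton (n := Module.finrank ℝ E) hν0,
      LinearMap.finrank_range_of_inj (f := D.toLinearMap) hD]

theorem exists_isUnitNormal [FiniteDimensional ℝ E] [FiniteDimensional ℝ F]
    (hfin : Module.finrank ℝ F = Module.finrank ℝ E + 1)
    (hD : Function.Injective D) : ∃ ν, IsUnitNormal D ν := by
  obtain ⟨ν, hν, hDν⟩ := exists_norm_map_eq_one_map_eq_zero (D := LinearMap.id)
    Function.injective_id D.adjoint.toLinearMap (by rw [hfin]; exact Nat.lt_succ_self _)
  refine ⟨ν, isUnitNormal_of_inner_eq_zero hfin hD hν fun v => ?_⟩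
  rw [← ContinuousLinearMap.adjoint_inner_right]
  exact (congrArg (⟪v, ·⟫) hDν).trans (inner_zero_right v)

namespace IsUnitNormal

theorem inner_eq_zero (h : IsUnitNormal D ν) (v : E) : ⟪D v, ν⟫ = 0 :=
  Submodule.mem_orthogonal_singleton_iff_inner_left.1
    (h.range_eq ▸ LinearMap.mem_range_self D.toLinearMap v)

theorem inner_self (h : IsUnitNormal D ν) : ⟪ν, ν⟫ = 1 := by
  rw [real_inner_self_eq_norm_sq, h.norm_eq, one_pow]

theorem neg (h : IsUnitNormal D ν) : IsUnitNormal D (-ν) where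
  norm_eq := (norm_neg ν).trans h.norm_eq
  range_eq := by rw [← neg_one_smul ℝ, Submodule.span_singleton_smul_eq (by simp), h.range_eq]

theorem starProjection_orthogonal [D.range.HasOrthogonalProjection]
    (h : IsUnitNormal D ν) (z : F) : D.rangeᗮ.starProjection z = ⟪z, ν⟫ • ν := by
  have hrange : D.rangeᗮ = ℝ ∙ ν := by rw [h.range_eq, Submodule.orthogonal_orthogonal]
  simp only [hrange]
  rw [Submodule.starProjection_unit_singleton ℝ h.norm_eq, real_inner_comm]

theorem eq_zero (h : IsUnitNormal D ν) {z : F} (hν : ⟪z, ν⟫ = 0) (hz : ∀ v, ⟪z, D v⟫ = 0) :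
    z = 0 := by
  obtain ⟨v, rfl⟩ : z ∈ D.range := by
    rwa [h.range_eq, Submodule.mem_orthogonal_singleton_iff_inner_left]
  exact inner_self_eq_zero.1 (hz v)

theorem eq_or_eq_neg {ν' : F} (h : IsUnitNormal D ν) (h' : IsUnitNormal D ν') :
    ν' = ν ∨ ν' = -ν := by
  have hmem : ν' ∈ ℝ ∙ ν := by
    rw [← Submodule.orthogonal_orthogonal (ℝ ∙ ν), ← h.range_eq, h'.range_eq]
    exact Submodule.le_orthogonal_orthogonal _ (Submodule.mem_span_singleton_self ν')
  obtain ⟨c, rfl⟩ := Submodule.mem_span_singleton.1 hmem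
  have hc := h'.norm_eq
  rw [norm_smul, h.norm_eq, mul_one, Real.norm_eq_abs] at hc
  rcases eq_or_eq_neg_of_abs_eq hc with rfl | rfl
  · exact .inl (one_smul _ _)
  · exact .inr (neg_one_smul _ _)

end IsUnitNormal

end UnitNormal

/-- `X` restricts to an immersion of the open set `V` as a hypersurface with the smooth unit normal
field `N`. -/
structure IsOrientedHypersurface {n : ℕ} (X : 𝔼 n → 𝔼 (n + 1)) (V : Set (𝔼 n))
    (N : 𝔼 n → 𝔼 (n + 1)) : Prop extends IsImmersionOn X V where
  contDiffAt_normal : ∀ y ∈ V, ContDiffAt ℝ ∞ N y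
  isUnitNormal : ∀ y ∈ V, IsUnitNormal (fderiv ℝ X y) (N y)

section OrientedHypersurface

variable {n : ℕ} {X : 𝔼 n → 𝔼 (n + 1)} {U V : Set (𝔼 n)} {N : 𝔼 n → 𝔼 (n + 1)} {y : 𝔼 n}

theorem IsImmersionOn.exists_isOrientedHypersurface (h : IsImmersionOn X U) (hy : y ∈ U) :
    ∃ V ⊆ U, y ∈ V ∧ ∃ N, IsOrientedHypersurface X V N := by
  have hfin : Module.finrank ℝ (𝔼 (n + 1)) = Module.finrank ℝ (𝔼 n) + 1 := by
    simp only [finrank_euclideanSpace_fin]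
  obtain ⟨ν, hν⟩ := exists_isUnitNormal hfin (h.injective y hy)
  let N₁ : 𝔼 n → 𝔼 (n + 1) := fun z => ν - fderiv ℝ X z (leftInv (fderiv ℝ X z) ν)
  have hN₁ : ∀ z ∈ U, ContDiffAt ℝ ∞ N₁ z := fun z hz =>
    contDiffAt_const.sub (((h.contDiffAt z hz).fderiv_right (by simp)).clm_apply
      ((h.contDiffAt_leftInv_fderiv hz).clm_apply contDiffAt_const))
  have hperp : ∀ z ∈ U, ∀ v, ⟪fderiv ℝ X z v, N₁ z⟫ = 0 := fun z hz v =>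
    Submodule.inner_right_of_mem_orthogonal (LinearMap.mem_range_self (fderiv ℝ X z).toLinearMap v)
      (by simpa only [N₁, map_leftInv (h.injective z hz)] using
        Submodule.sub_starProjection_mem_orthogonal ν)
  have hNy : N₁ y = ν := by
    simp only [N₁]
    rw [leftInv_eq_zero hν.inner_eq_zero, map_zero, sub_zero]
  have hy0 : N₁ y ≠ 0 := norm_ne_zero_iff.1 (by rw [hNy, hν.norm_eq]; exact one_ne_zero)
  refine ⟨U ∩ N₁ ⁻¹' {0}ᶜ, inter_subset_left, ⟨hy, hy0⟩, fun z => ‖N₁ z‖⁻¹ • N₁ z,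
    ⟨⟨?_, fun z hz => h.contDiffAt z hz.1, fun z hz => h.injective z hz.1⟩, ?_, ?_⟩⟩
  · exact ContinuousOn.isOpen_inter_preimage
      (fun z hz => (hN₁ z hz).continuousAt.continuousWithinAt) h.isOpen isOpen_compl_singleton
  · exact fun z hz => (((hN₁ z hz.1).norm ℝ hz.2).inv (norm_ne_zero_iff.2 hz.2)).smul (hN₁ z hz.1)
  · refine fun z hz => isUnitNormal_of_inner_eq_zero hfin (h.injective z hz.1)
      (norm_smul_inv_norm hz.2) fun v => ?_
    rw [real_inner_smul_right, hperp z hz.1, mul_zero]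

namespace IsOrientedHypersurface

theorem neg (h : IsOrientedHypersurface X V N) : IsOrientedHypersurface X V (-N) where
  toIsImmersionOn := h.toIsImmersionOn
  contDiffAt_normal y hy := (h.contDiffAt_normal y hy).neg
  isUnitNormal y hy := (h.isUnitNormal y hy).neg

theorem mono (h : IsOrientedHypersurface X V N) (hU : IsOpen U) (hUV : U ⊆ V) :
    IsOrientedHypersurface X U N where
  isOpen := hU
  contDiffAt y hy := h.contDiffAt y (hUV hy)
  injective y hy := h.injective y (hUV hy)
  contDiffAt_normal y hy := h.contDiffAt_normal y (hUV hy)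
  isUnitNormal y hy := h.isUnitNormal y (hUV hy)

variable (h : IsOrientedHypersurface X V N) (hy : y ∈ V)
include h hy

theorem inner_fderiv_normal_fderiv (v w : 𝔼 n) :
    ⟪fderiv ℝ N y v, fderiv ℝ X y w⟫ = -⟪hess X y v w, N y⟫ := by
  have hX := h.contDiffAt y hy
  rw [inner_fderiv_of_inner_eq_const (f := N) (g := fun z => fderiv ℝ X z w) (c := 0)
    ((h.contDiffAt_normal y hy).differentiableAt (by simp))
    ((contDiffAt_fderiv_apply hX w).differentiableAt (by simp)) ?_ v,
    fderiv_fderiv_apply hX, real_inner_comm]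
  filter_upwards [h.isOpen.mem_nhds hy] with z hz
  rw [real_inner_comm]
  exact (h.isUnitNormal z hz).inner_eq_zero w

theorem inner_fderiv_normal_self (v : 𝔼 n) : ⟪fderiv ℝ N y v, N y⟫ = 0 := by
  have hN := (h.contDiffAt_normal y hy).differentiableAt (by simp)
  have hself := inner_fderiv_of_inner_eq_const (c := 1) hN hN (by
    filter_upwards [h.isOpen.mem_nhds hy] with z hz
    exact (h.isUnitNormal z hz).inner_self) v
  rw [real_inner_comm] at hself ⊢
  linarith

theorem secondFF_eq (v w : 𝔼 n) : secondFF X y v w = ⟪hess X y v w, N y⟫ • N y := by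
  rw [secondFF, fderiv_fderiv_apply (h.contDiffAt y hy),
    (h.isUnitNormal y hy).starProjection_orthogonal]

theorem norm_secondFF_sq (v w : 𝔼 n) : ‖secondFF X y v w‖ ^ 2 = ⟪hess X y v w, N y⟫ ^ 2 := by
  rw [h.secondFF_eq hy, norm_smul, (h.isUnitNormal y hy).norm_eq, mul_one, Real.norm_eq_abs,
    sq_abs]

theorem sectionalCurvature_eq {u v : 𝔼 n} (huu : metric X y u u = 1) (hvv : metric X y v v = 1)
    (huv : metric X y u v = 0) :
    sectionalCurvature X y u v
      = ⟪hess X y u u, N y⟫ * ⟪hess X y v v, N y⟫ - ⟪hess X y u v, N y⟫ ^ 2 := by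
  rw [sectionalCurvature, h.curvature_eq hy, huu, hvv, huv, secondFF_symm (h.contDiffAt y hy) v u,
    real_inner_self_eq_norm_sq, h.norm_secondFF_sq hy,
    h.secondFF_eq hy, h.secondFF_eq hy u u, real_inner_smul_left, real_inner_smul_right,
    (h.isUnitNormal y hy).inner_self]
  ring

end IsOrientedHypersurface

end OrientedHypersurface

/-! ### Equality in the Casorati inequality -/

section Equality

section Frames

variable {E F : Type*} [AddCommGroup E] [Module ℝ E] [NormedAddCommGroup F]
  [InnerProductSpace ℝ F] {k : ℕ}

theorem exists_orthonormal_map_vecCons [FiniteDimensional ℝ E] {D : E →ₗ[ℝ] F}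
    (hD : Function.Injective D) {f : Fin k → E} (hf : Orthonormal ℝ fun i => D (f i))
    (hk : k < Module.finrank ℝ E) :
    ∃ u, Orthonormal ℝ fun i => D ((Matrix.vecCons u f : Fin (k + 1) → E) i) := by
  obtain ⟨u, hu, hperp⟩ := exists_norm_map_eq_one_map_eq_zero hD
    (LinearMap.pi fun i => (innerSL ℝ (D (f i))).toLinearMap ∘ₗ D) (by simpa using hk)
  refine ⟨u, ?_⟩
  have hcons : (fun i => D ((Matrix.vecCons u f : Fin (k + 1) → E) i))
      = Matrix.vecCons (D u) fun i => D (f i) := by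
    funext i
    induction i using Fin.cases <;> rfl
  rw [hcons, orthonormal_vecCons_iff]
  refine ⟨hu, fun i => ?_, hf⟩
  rw [real_inner_comm]
  exact congrFun hperp i

theorem exists_orthonormal_map [FiniteDimensional ℝ E] {D : E →ₗ[ℝ] F}
    (hD : Function.Injective D) (hk : k ≤ Module.finrank ℝ E) :
    ∃ f : Fin k → E, Orthonormal ℝ fun i => D (f i) := by
  induction k with
  | zero => exact ⟨Fin.elim0, fun i => i.elim0, fun i => i.elim0⟩
  | succ k ih =>
    obtain ⟨f, hf⟩ := ih (Nat.le_of_succ_le hk)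
    obtain ⟨u, hu⟩ := exists_orthonormal_map_vecCons hD hf hk
    exact ⟨_, hu⟩

theorem exists_basis_eq_of_orthonormal_map {ι : Type*} [Fintype ι] [Nonempty ι] {D : E →ₗ[ℝ] F}
    {e : ι → E} (he : Orthonormal ℝ fun i => D (e i))
    (hcard : Fintype.card ι = Module.finrank ℝ E) : ∃ b : Module.Basis ι ℝ E, ⇑b = e :=
  have hli : LinearIndependent ℝ e := LinearIndependent.of_comp D he.linearIndependent
  ⟨basisOfLinearIndependentOfCardEqFinrank hli hcard, by simp⟩

theorem isCompact_setOf_orthonormal_map {ι E : Type*} [Finite ι] [NormedAddCommGroup E]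
    [InnerProductSpace ℝ E] [FiniteDimensional ℝ E] [FiniteDimensional ℝ F] {D : E →L[ℝ] F}
    (hD : Function.Injective D) : IsCompact {f : ι → E | Orthonormal ℝ fun i => D (f i)} := by
  classical
  have := Fintype.ofFinite ι
  refine Metric.isCompact_of_isClosed_isBounded ?_ ?_
  · simp only [orthonormal_iff_ite, ofPred_forall]
    exact isClosed_iInter fun i => isClosed_iInter fun j =>
      isClosed_eq (by fun_prop) continuous_const
  · refine (Metric.isBounded_closedBall (x := (0 : ι → E)) (r := ‖leftInv D‖)).subset fun f hf => ?_
    rw [mem_closedBall_zero_iff, pi_norm_le_iff_of_nonneg (norm_nonneg _)]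
    intro i
    calc ‖f i‖ = ‖leftInv D (D (f i))‖ := by rw [leftInv_map hD]
      _ ≤ ‖leftInv D‖ * ‖D (f i)‖ := (leftInv D).le_opNorm _
      _ = ‖leftInv D‖ := by rw [hf.1 i, mul_one]

end Frames

theorem two_mul_sum_sum_lt {ι : Type*} [Fintype ι] [LinearOrder ι] {f : ι → ι → ℝ}
    (hsymm : ∀ i j, f i j = f j i) (hdiag : ∀ i, f i i = 0) :
    2 * ∑ i, ∑ j ∈ Finset.univ.filter (fun j => i < j), f i j = ∑ i, ∑ j, f i j := by
  have hsplit : ∀ i j, f i j = (if i < j then f i j else 0) + if j < i then f j i else 0 := by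
    intro i j
    rcases lt_trichotomy i j with h | rfl | h
    · simp only [h, h.not_gt, if_true, if_false, add_zero]
    · simp only [lt_irrefl, if_false, add_zero, hdiag]
    · simp only [h, h.not_gt, if_true, if_false, zero_add, hsymm i j]
  have hsum : ∑ i, ∑ j, f i j
      = ∑ i, ∑ j, (if i < j then f i j else 0) + ∑ i, ∑ j, if j < i then f j i else 0 := by
    simp only [← Finset.sum_add_distrib]
    exact Finset.sum_congr rfl fun i _ => Finset.sum_congr rfl fun j _ => hsplit i j
  rw [hsum, Finset.sum_comm (f := fun i j => if j < i then f j i else 0), two_mul]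
  simp only [Finset.sum_filter]

theorem sum_sum_sub_diagonal_sq {ι : Type*} [Fintype ι] [DecidableEq ι] (b : ι → ι → ℝ)
    (d : ι → ℝ) :
    ∑ i, ∑ j, (b i j - if i = j then d i else 0) ^ 2
      = ∑ i, ∑ j, b i j ^ 2 - 2 * ∑ i, d i * b i i + ∑ i, d i ^ 2 := by
  simp only [sub_sq, ite_pow, Finset.sum_add_distrib, Finset.sum_sub_distrib, Finset.mul_sum]
  simp [mul_assoc, mul_comm (b _ _)]

theorem exists_eq_diagonal_of_sum_diag_sq_eq {k : ℕ} {b : Fin (k + 1) → Fin (k + 1) → ℝ}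
    (h : (∑ i, b i i) ^ 2 = (k + 2) / 2 *
      (∑ i, ∑ j, b i j ^ 2 + ∑ i : Fin k, ∑ j : Fin k, b i.succ j.succ ^ 2)) :
    ∃ l : ℝ, ∀ i j, b i j = if i = j then (if i = 0 then 2 * l else l) else 0 := by
  have hk : (k + 2 : ℝ) ≠ 0 := by positivity
  obtain ⟨l, hl⟩ : ∃ l : ℝ, ∑ i, b i i = (k + 2) * l := ⟨(∑ i, b i i) / (k + 2), by field_simp⟩
  have hfull := sum_sum_sub_diagonal_sq b fun i => if i = 0 then 2 * l else l
  have hsucc := sum_sum_sub_diagonal_sq (fun i j : Fin k => b i.succ j.succ) fun _ => l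
  simp only [Fin.sum_univ_succ (fun i => _ * b i i), Fin.sum_univ_succ (fun _ => ite _ _ _ ^ 2),
    Fin.succ_ne_zero, if_true, if_false, ← Finset.mul_sum, Finset.sum_const, Finset.card_univ,
    Fintype.card_fin, nsmul_eq_mul] at hfull hsucc
  rw [hl] at h
  rw [Fin.sum_univ_succ] at hl
  have hS := mul_left_cancel₀ hk (show (k + 2 : ℝ) * (2 * (k + 2) * l ^ 2) = (k + 2) *
    (∑ i, ∑ j, b i j ^ 2 + ∑ i : Fin k, ∑ j : Fin k, b i.succ j.succ ^ 2) by linarith)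
  have hsum : ∑ i, ∑ j, (b i j - if i = j then (if i = 0 then 2 * l else l) else 0) ^ 2 ≤ 0 := by
    have hnonneg : 0 ≤ ∑ i : Fin k, ∑ j : Fin k, (b i.succ j.succ - if i = j then l else 0) ^ 2 :=
      Finset.sum_nonneg fun i _ => Finset.sum_nonneg fun j _ => sq_nonneg _
    have hlin : l * b 0 0 + l * ∑ i : Fin k, b i.succ i.succ = (k + 2) * l ^ 2 := by
      linear_combination l * hl
    linarith
  refine ⟨l, fun i j => sub_eq_zero.1 (pow_eq_zero_iff two_ne_zero |>.1 ?_)⟩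
  have hzero := (hsum.antisymm (Finset.sum_nonneg fun i _ => Finset.sum_nonneg fun j _ =>
    sq_nonneg _))
  rw [Finset.sum_eq_zero_iff_of_nonneg fun i _ => Finset.sum_nonneg fun j _ => sq_nonneg _] at hzero
  exact (Finset.sum_eq_zero_iff_of_nonneg fun j _ => sq_nonneg _).1 (hzero i (Finset.mem_univ i)) j
    (Finset.mem_univ j)

theorem IsImmersionOn.exists_frame_deltaCasorati_eq {k m : ℕ} {X : 𝔼 (k + 1) → 𝔼 m}
    {U : Set (𝔼 (k + 1))} {y : 𝔼 (k + 1)} (h : IsImmersionOn X U) (hy : y ∈ U) :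
    ∃ e : Fin (k + 1) → 𝔼 (k + 1), IsOrthonormalFamily X y e ∧
      deltaCasorati X y e = 1 / 2 * casorati X y e +
        (k + 2) / (2 * (k + 1)) * casorati X y fun i : Fin k => e i.succ := by
  have hinj := h.injective y hy
  have hcont : Continuous fun f : Fin k → 𝔼 (k + 1) => casorati X y f := by
    simp only [casorati, secondFF, fderiv_fderiv_apply (h.contDiffAt y hy)]
    fun_prop
  obtain ⟨f, hf, hmin⟩ := (isCompact_setOf_orthonormal_map hinj).exists_isMinOn
    (exists_orthonormal_map (k := k) (D := (fderiv ℝ X y).toLinearMap) hinj (by simp))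
    hcont.continuousOn
  have hleast : IsLeast {c | ∃ g : Fin k → 𝔼 (k + 1), IsOrthonormalFamily X y g ∧
      c = casorati X y g} (casorati X y f) := by
    refine ⟨⟨f, hf, rfl⟩, ?_⟩
    rintro c ⟨g, hg, rfl⟩
    exact hmin hg
  obtain ⟨u, hu⟩ := exists_orthonormal_map_vecCons (D := (fderiv ℝ X y).toLinearMap) hinj hf
    (by simp)
  refine ⟨Matrix.vecCons u f, hu, ?_⟩
  rw [deltaCasorati, show sInf {c | ∃ g : Fin (k + 1 - 1) → 𝔼 (k + 1),
    IsOrthonormalFamily X y g ∧ c = casorati X y g} = casorati X y f from hleast.csInf_eq]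
  push_cast
  simp only [Matrix.cons_val_succ]
  ring

theorem IsOrientedHypersurface.exists_principal_frame {k : ℕ} (hk : k ≠ 0)
    {X : 𝔼 (k + 1) → 𝔼 (k + 2)} {V : Set (𝔼 (k + 1))} {N : 𝔼 (k + 1) → 𝔼 (k + 2)} {y : 𝔼 (k + 1)}
    (h : IsOrientedHypersurface X V N) (hy : y ∈ V)
    (hid : ∀ e : Fin (k + 1) → 𝔼 (k + 1), IsOrthonormalFamily X y e →
      normalizedScalarCurvature X y e = deltaCasorati X y e) :
    ∃ (l : ℝ) (e : Fin (k + 1) → 𝔼 (k + 1)), IsOrthonormalFamily X y e ∧ ∀ i j,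
      ⟪hess X y (e i) (e j), N y⟫ = if i = j then (if i = 0 then 2 * l else l) else 0 := by
  obtain ⟨e, he, hdelta⟩ := h.exists_frame_deltaCasorati_eq hy
  set b : Fin (k + 1) → Fin (k + 1) → ℝ := fun i j => ⟪hess X y (e i) (e j), N y⟫ with hb
  have hsymm : ∀ i j, b i j = b j i := fun i j => by
    simp only [hb, hess_symm (h.contDiffAt y hy) (e i)]
  have hmetric : ∀ i j, metric X y (e i) (e j) = if i = j then 1 else 0 := orthonormal_iff_ite.1 he
  have hK : ∀ i, ∀ j ∈ Finset.univ.filter (fun j => i < j),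
      sectionalCurvature X y (e i) (e j) = b i i * b j j - b i j ^ 2 := fun i j hj =>
    have hij : i ≠ j := (Finset.mem_filter.1 hj).2.ne
    h.sectionalCurvature_eq hy (by simp [hmetric]) (by simp [hmetric]) (by simp [hmetric, hij])
  have hGauss : 2 * ∑ i, ∑ j ∈ Finset.univ.filter (fun j => i < j),
      sectionalCurvature X y (e i) (e j) = (∑ i, b i i) ^ 2 - ∑ i, ∑ j, b i j ^ 2 := by
    rw [Finset.sum_congr rfl fun i _ => Finset.sum_congr rfl (hK i), two_mul_sum_sum_lt
      (f := fun i j => b i i * b j j - b i j ^ 2) (fun i j => by rw [hsymm i j]; ring)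
      fun i => by ring]
    simp only [Finset.sum_sub_distrib, sq (∑ i, b i i), Finset.sum_mul_sum]
  obtain ⟨l, hl⟩ := exists_eq_diagonal_of_sum_diag_sq_eq (b := b) (by
    have heq := hid e he
    rw [hdelta, normalizedScalarCurvature] at heq
    simp only [casorati, h.norm_secondFF_sq hy] at heq
    have hk' : (k : ℝ) ≠ 0 := Nat.cast_ne_zero.2 hk
    push_cast at heq
    rw [add_sub_cancel_right] at heq
    field_simp at heq
    simp only [hb] at hGauss ⊢
    linarith)
  exact ⟨l, e, he, hl⟩

end Equality

/-! ### The shape operator of an ideal hypersurface -/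

section Shape

variable {E F : Type*} [NormedAddCommGroup E] [InnerProductSpace ℝ E] [NormedAddCommGroup F]
  [InnerProductSpace ℝ F] {D A : E →L[ℝ] F} {l : ℝ} {η : E}

/-- `A` is the differential of the unit normal field of a hypersurface whose parametrization has
differential `D` and whose principal curvatures are `l, …, l, 2 l`; the principal direction of `2 l`
is the unit vector `D η`. -/
structure IsIdealShape (D A : E →L[ℝ] F) (l : ℝ) (η : E) : Prop where
  norm_eq : ‖D η‖ = 1
  map_eq : ∀ v, A v = -l • (D v + ⟪D v, D η⟫ • D η)

namespace IsIdealShape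

theorem inner_self (h : IsIdealShape D A l η) : ⟪D η, D η⟫ = 1 := by
  rw [real_inner_self_eq_norm_sq, h.norm_eq, one_pow]

theorem neg (h : IsIdealShape D A l η) : IsIdealShape D (-A) (-l) η where
  norm_eq := h.norm_eq
  map_eq v := by rw [neg_apply, h.map_eq, neg_smul, neg_neg, neg_neg]

theorem smul {s : ℝ} (h : IsIdealShape D A l η) (hs : s * s = 1) : IsIdealShape D A l (s • η) where
  norm_eq := by
    rw [map_smul, norm_smul, h.norm_eq, mul_one, Real.norm_eq_abs, abs_eq_abs.2]
    exacts [abs_one, mul_self_eq_one_iff.1 hs]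
  map_eq v := by
    rw [map_smul, real_inner_smul_right, smul_smul, mul_right_comm, hs, one_mul, h.map_eq]

theorem normalize {c : ℝ} {w : E} (h : IsIdealShape D A l η) (hw : w = c • η) (hDw : D w ≠ 0) :
    IsIdealShape D A l (‖D w‖⁻¹ • w) := by
  have hnorm : ‖D w‖ = |c| := by
    rw [hw, map_smul, norm_smul, h.norm_eq, mul_one, Real.norm_eq_abs]
  have hc : |c| ≠ 0 := by rwa [← hnorm, norm_ne_zero_iff]
  rw [hnorm, hw, smul_smul]
  refine h.smul ?_
  field_simp
  exact (sq_abs c).symm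

variable [FiniteDimensional ℝ E] [FiniteDimensional ℝ F]

theorem leftInv_map_eq (h : IsIdealShape D A l η) (hD : Function.Injective D) (v : E) :
    leftInv D (A v) = -l • (v + ⟪D v, D η⟫ • η) := by
  rw [h.map_eq, map_smul, map_add, map_smul, leftInv_map hD, leftInv_map hD]

theorem trace_leftInv_comp (h : IsIdealShape D A l η) (hD : Function.Injective D) :
    LinearMap.trace ℝ E (leftInv D ∘L A).toLinearMap = -l * (Module.finrank ℝ E + 1) := by
  let θ : E →ₗ[ℝ] ℝ := (innerSL ℝ (D η)).toLinearMap ∘ₗ D.toLinearMap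
  have hrank : (leftInv D ∘L A).toLinearMap = -l • (LinearMap.id + θ.smulRight η) := by
    refine LinearMap.ext fun v => (h.leftInv_map_eq hD v).trans ?_
    rw [real_inner_comm]
    rfl
  have hθ : θ η = 1 := h.inner_self
  rw [hrank, map_smul, map_add, LinearMap.trace_id, LinearMap.trace_smulRight, hθ, smul_eq_mul]

theorem curvature_unique {l' : ℝ} {η' : E} (h : IsIdealShape D A l η) (h' : IsIdealShape D A l' η')
    (hD : Function.Injective D) : l' = l := by
  have htrace := (h'.trace_leftInv_comp hD).symm.trans (h.trace_leftInv_comp hD)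
  exact neg_inj.1 (mul_right_cancel₀ (by positivity) htrace)

theorem exists_eq_smul {l' : ℝ} {η' : E} (h : IsIdealShape D A l η) (h' : IsIdealShape D A l' η')
    (hD : Function.Injective D) (hl : l ≠ 0) : ∃ s : ℝ, s * s = 1 ∧ η' = s • η := by
  obtain rfl := h.curvature_unique h' hD
  obtain ⟨s, rfl⟩ : ∃ s : ℝ, η' = s • η := ⟨⟪D η', D η⟫, hD <| by
    have hmap := smul_right_injective F (neg_ne_zero.2 hl)
      ((h'.map_eq η').symm.trans (h.map_eq η'))
    rw [h'.inner_self, one_smul] at hmap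
    rw [map_smul]
    exact add_left_cancel hmap⟩
  have hself := h'.inner_self
  rw [map_smul, real_inner_smul_left, real_inner_smul_right, h.inner_self, mul_one] at hself
  exact ⟨s, hself, rfl⟩

end IsIdealShape

variable {n : ℕ} {X : 𝔼 n → 𝔼 (n + 1)} {V : Set (𝔼 n)} {N : 𝔼 n → 𝔼 (n + 1)} {y : 𝔼 n}

theorem IsOrientedHypersurface.exists_isIdealShape (hn : 2 ≤ n) (h : IsOrientedHypersurface X V N)
    (hy : y ∈ V) (hid : ∀ e : Fin n → 𝔼 n, IsOrthonormalFamily X y e →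
      normalizedScalarCurvature X y e = deltaCasorati X y e) :
    ∃ l η, IsIdealShape (fderiv ℝ X y) (fderiv ℝ N y) l η := by
  obtain ⟨k, rfl⟩ := Nat.exists_eq_add_of_le' (Nat.one_le_of_lt hn)
  obtain ⟨l, e, he, hl⟩ := h.exists_principal_frame (by lia) hy hid
  set D := fderiv ℝ X y with hD
  have hon : ∀ i j, ⟪D (e i), D (e j)⟫ = if i = j then (1 : ℝ) else 0 := orthonormal_iff_ite.1 he
  obtain ⟨b, hb⟩ := exists_basis_eq_of_orthonormal_map (D := D.toLinearMap) he (by simp)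
  refine ⟨l, e 0, he.1 0, fun v => ?_⟩
  let A : 𝔼 (k + 1) →L[ℝ] 𝔼 (k + 2) :=
    fderiv ℝ N y + l • (D + (innerSL ℝ (D (e 0)) ∘L D).smulRight (D (e 0)))
  have hA : ∀ v, A v = fderiv ℝ N y v + l • (D v + ⟪D v, D (e 0)⟫ • D (e 0)) := fun v => by
    rw [real_inner_comm]
    rfl
  have htangent : ∀ i j, ⟪A (e i), D (e j)⟫ = 0 := fun i j => by
    rw [hA, inner_add_left, h.inner_fderiv_normal_fderiv hy, hl, real_inner_smul_left,
      inner_add_left, real_inner_smul_left, hon, hon, hon]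
    rcases eq_or_ne i j with rfl | hij
    · rcases eq_or_ne i 0 with rfl | hi
      · simp only [if_true]
        ring
      · simp only [if_true, hi, if_false]
        ring
    · rcases eq_or_ne i 0 with rfl | hi
      · simp [hij]
      · simp [hij, hi]
  have hnormal : ∀ v, ⟪A v, N y⟫ = 0 := fun v => by
    simp only [hA, inner_add_left, real_inner_smul_left, h.inner_fderiv_normal_self hy, hD,
      (h.isUnitNormal y hy).inner_eq_zero, mul_zero, add_zero]
  have hzero : A.toLinearMap = 0 := b.ext fun i => by
    refine (h.isUnitNormal y hy).eq_zero (hnormal _) fun w => ?_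
    have hfun : (innerSL ℝ (A (b i)) ∘L D).toLinearMap = 0 := b.ext fun j => by
      rw [hb]
      exact htangent i j
    exact LinearMap.congr_fun hfun w
  rw [neg_smul]
  exact eq_neg_of_add_eq_zero_left ((hA v).symm.trans (LinearMap.congr_fun hzero v))

/-- The function `λ` for which the principal curvatures of an ideal hypersurface are
`λ, …, λ, 2 λ`: the trace of the shape operator `-dN`, divided by `n + 1`. -/
def idealCurvature (X N : 𝔼 n → 𝔼 (n + 1)) (y : 𝔼 n) : ℝ :=
  -(1 / (n + 1)) * LinearMap.trace ℝ (𝔼 n) (leftInv (fderiv ℝ X y) ∘L fderiv ℝ N y).toLinearMap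

theorem IsIdealShape.idealCurvature_eq {l : ℝ} {η : 𝔼 n} (hX : Function.Injective (fderiv ℝ X y))
    (h : IsIdealShape (fderiv ℝ X y) (fderiv ℝ N y) l η) : idealCurvature X N y = l := by
  rw [idealCurvature, h.trace_leftInv_comp hX, finrank_euclideanSpace_fin]
  field_simp

theorem IsOrientedHypersurface.contDiffAt_idealCurvature (h : IsOrientedHypersurface X V N)
    (hy : y ∈ V) : ContDiffAt ℝ ∞ (idealCurvature X N) y := by
  let tr : (𝔼 n →L[ℝ] 𝔼 n) →L[ℝ] ℝ :=
    (LinearMap.trace ℝ (𝔼 n) ∘ₗ ContinuousLinearMap.coeLM ℝ).toContinuousLinearMap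
  have htr : ContDiffAt ℝ ∞
      (fun z => tr (leftInv (fderiv ℝ X z) ∘L fderiv ℝ N z)) y :=
    tr.contDiff.contDiffAt.comp y ((h.contDiffAt_leftInv_fderiv hy).clm_comp
      ((h.contDiffAt_normal y hy).fderiv_right (by simp)))
  exact contDiffAt_const.mul htr

/-- An oriented hypersurface with principal curvatures `λ, …, λ, 2 λ` at every point, where
`λ = idealCurvature X N` may vanish. -/
structure IsOrientedIdealHypersurface (X : 𝔼 n → 𝔼 (n + 1)) (V : Set (𝔼 n))
    (N : 𝔼 n → 𝔼 (n + 1)) : Prop extends IsOrientedHypersurface X V N where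
  exists_isIdealShape : ∀ y ∈ V, ∃ η,
    IsIdealShape (fderiv ℝ X y) (fderiv ℝ N y) (idealCurvature X N y) η

/-- An oriented hypersurface with principal curvatures `λ, …, λ, 2 λ`, where
`λ = idealCurvature X N` is positive, and with the smooth unit principal vector field `η` for
`2 λ`. -/
structure IsIdealHypersurface (X : 𝔼 n → 𝔼 (n + 1)) (V : Set (𝔼 n)) (N : 𝔼 n → 𝔼 (n + 1))
    (η : 𝔼 n → 𝔼 n) : Prop extends IsOrientedHypersurface X V N where
  contDiffAt_eta : ∀ y ∈ V, ContDiffAt ℝ ∞ η y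
  idealCurvature_pos : ∀ y ∈ V, 0 < idealCurvature X N y
  isIdealShape : ∀ y ∈ V,
    IsIdealShape (fderiv ℝ X y) (fderiv ℝ N y) (idealCurvature X N y) (η y)

namespace IsIdealHypersurface

variable {η : 𝔼 n → 𝔼 n}

theorem mono {U : Set (𝔼 n)} (h : IsIdealHypersurface X V N η) (hU : IsOpen U) (hUV : U ⊆ V) :
    IsIdealHypersurface X U N η where
  toIsOrientedHypersurface := h.toIsOrientedHypersurface.mono hU hUV
  contDiffAt_eta y hy := h.contDiffAt_eta y (hUV hy)
  idealCurvature_pos y hy := h.idealCurvature_pos y (hUV hy)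
  isIdealShape y hy := h.isIdealShape y (hUV hy)

theorem smul {s : ℝ} (h : IsIdealHypersurface X V N η) (hs : s * s = 1) :
    IsIdealHypersurface X V N (s • η) where
  toIsOrientedHypersurface := h.toIsOrientedHypersurface
  contDiffAt_eta y hy := contDiffAt_const.smul (h.contDiffAt_eta y hy)
  idealCurvature_pos := h.idealCurvature_pos
  isIdealShape y hy := (h.isIdealShape y hy).smul hs

end IsIdealHypersurface

theorem IsOrientedIdealHypersurface.exists_isIdealHypersurface
    (h : IsOrientedIdealHypersurface X V N) (hy : y ∈ V) (hpos : 0 < idealCurvature X N y) :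
    ∃ V', y ∈ V' ∧ ∃ η, IsIdealHypersurface X V' N η := by
  obtain ⟨η₀, hη₀⟩ := h.exists_isIdealShape y hy
  -- The shape operator minus `λ` has the principal line of `2 λ` as its range.
  let w : 𝔼 n → 𝔼 n := fun z =>
    -leftInv (fderiv ℝ X z) (fderiv ℝ N z η₀) - idealCurvature X N z • η₀
  have hw : ∀ z ∈ V, ContDiffAt ℝ ∞ w z := fun z hz =>
    ((h.contDiffAt_leftInv_fderiv hz).clm_apply
      (contDiffAt_fderiv_apply (h.contDiffAt_normal z hz) η₀)).neg.sub
      ((h.contDiffAt_idealCurvature hz).smul contDiffAt_const)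
  have hw_eq : ∀ z ∈ V, ∀ η,
      IsIdealShape (fderiv ℝ X z) (fderiv ℝ N z) (idealCurvature X N z) η →
      w z = (idealCurvature X N z * ⟪fderiv ℝ X z η₀, fderiv ℝ X z η⟫) • η := fun z hz η hη => by
    simp only [w, hη.leftInv_map_eq (h.injective z hz)]
    module
  have hDw : ∀ z ∈ V, w z ≠ 0 → fderiv ℝ X z (w z) ≠ 0 := fun z hz hwz =>
    (map_ne_zero_iff _ (h.injective z hz)).2 hwz
  have hwy : w y ≠ 0 := by
    rw [hw_eq y hy η₀ hη₀, hη₀.inner_self, mul_one]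
    exact smul_ne_zero hpos.ne' fun h0 => by simpa [h0] using hη₀.norm_eq
  have hcont : ContinuousOn (fun z => (idealCurvature X N z, w z)) V := fun z hz =>
    ((h.contDiffAt_idealCurvature hz).continuousAt.prodMk
      (hw z hz).continuousAt).continuousWithinAt
  have hopen : IsOpen (V ∩ (fun z => (idealCurvature X N z, w z)) ⁻¹' Ioi 0 ×ˢ {0}ᶜ) :=
    hcont.isOpen_inter_preimage h.isOpen (isOpen_Ioi.prod isOpen_compl_singleton)
  refine ⟨V ∩ (fun z => (idealCurvature X N z, w z)) ⁻¹' Ioi 0 ×ˢ {0}ᶜ,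
    ⟨hy, hpos, hwy⟩, fun z => ‖fderiv ℝ X z (w z)‖⁻¹ • w z,
    h.toIsOrientedHypersurface.mono hopen inter_subset_left, ?_,
    fun z hz => hz.2.1, ?_⟩
  · rintro z ⟨hz, -, hwz⟩
    exact (((((h.contDiffAt z hz).fderiv_right (by simp)).clm_apply (hw z hz)).norm ℝ
      (hDw z hz hwz)).inv (norm_ne_zero_iff.2 (hDw z hz hwz))).smul (hw z hz)
  · rintro z ⟨hz, -, hwz⟩
    obtain ⟨η, hη⟩ := h.exists_isIdealShape z hz
    exact hη.normalize (hw_eq z hz η hη) (hDw z hz hwz)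

end Shape

/-! ### The Codazzi equation of an ideal hypersurface -/

section Codazzi

variable {E F : Type*} [NormedAddCommGroup E] [InnerProductSpace ℝ E] [NormedAddCommGroup F]
  [InnerProductSpace ℝ F] {D R : E →L[ℝ] F} {ν : F} {η : E} {ℓ : E →L[ℝ] ℝ} {l : ℝ}

theorem exists_norm_map_eq_one_inner_eq_zero {ι : Type*} [Fintype ι] [FiniteDimensional ℝ E]
    (hD : Function.Injective D) (w : ι → F) (hcard : Fintype.card ι < Module.finrank ℝ E) :
    ∃ u, ‖D u‖ = 1 ∧ ∀ i, ⟪D u, w i⟫ = 0 := by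
  obtain ⟨u, hu, huw⟩ := exists_norm_map_eq_one_map_eq_zero (D := D.toLinearMap) hD
    (LinearMap.pi fun i => (innerSL ℝ (w i)).toLinearMap ∘ₗ D.toLinearMap) (by simpa using hcard)
  exact ⟨u, hu, fun i => (real_inner_comm _ _).trans (congrFun huw i)⟩

/-- The relations between the differentials `ℓ` of the principal curvature `λ` and `R` of the
principal field `ξ` of an ideal hypersurface, at a point where the parametrization has differential
`D`, the unit normal is `ν`, `λ = l` and `ξ = D η`; the last one is the Codazzi equation. -/
structure IsCodazzi (D R : E →L[ℝ] F) (ν : F) (η : E) (ℓ : E →L[ℝ] ℝ) (l : ℝ) : Prop where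
  inner_principal : ∀ v, ⟪R v, D η⟫ = 0
  inner_normal : ∀ v, ⟪R v, ν⟫ = 2 * l * ⟪D v, D η⟫
  symm : ∀ u v, ℓ u • (D v + ⟪D v, D η⟫ • D η) + l • (⟪D v, R u⟫ • D η + ⟪D v, D η⟫ • R u)
    = ℓ v • (D u + ⟪D u, D η⟫ • D η) + l • (⟪D u, R v⟫ • D η + ⟪D u, D η⟫ • R v)

namespace IsCodazzi

theorem apply_eq_zero [FiniteDimensional ℝ E] (h : IsCodazzi D R ν η ℓ l)
    (hfin : 3 ≤ Module.finrank ℝ E) (hD : Function.Injective D) {v : E} (hv : ⟪D v, D η⟫ = 0) :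
    ℓ v = 0 := by
  obtain ⟨u, hu, huw⟩ := exists_norm_map_eq_one_inner_eq_zero hD ![D η, D v]
    (by rwa [Fintype.card_fin])
  have huη : ⟪D u, D η⟫ = 0 := huw 0
  have hvu : ⟪D v, D u⟫ = 0 := (real_inner_comm _ _).trans (huw 1)
  have hηu : ⟪D η, D u⟫ = 0 := (real_inner_comm _ _).trans huη
  have hinner := congrArg (⟪·, D u⟫) (h.symm u v)
  simp only [inner_add_left, real_inner_smul_left, hv, huη, hvu, hηu, real_inner_self_eq_norm_sq,
    hu] at hinner
  linarith

variable (h : IsCodazzi D R ν η ℓ l) (hη : ⟪D η, D η⟫ = 1) (hl : l ≠ 0) {v : E}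
  (hv : ⟪D v, D η⟫ = 0) (hℓv : ℓ v = 0)
include h hη hl hv hℓv

theorem inner_map_principal : ⟪D v, R η⟫ = 0 := by
  have hinner := congrArg (⟪·, D η⟫) (h.symm η v)
  simp only [inner_add_left, real_inner_smul_left, hℓv, hv, hη, h.inner_principal,
    real_inner_comm (R v) (D η)] at hinner
  exact (mul_eq_zero.1 (by linarith : l * ⟪D v, R η⟫ = 0)).resolve_left hl

theorem map_eq_smul : R v = (ℓ η / l) • D v := by
  have hsymm := h.symm η v
  simp only [hℓv, hv, hη, h.inner_map_principal hη hl hv hℓv, real_inner_comm (R v) (D η),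
    h.inner_principal, zero_smul, add_zero, zero_add, one_smul, smul_zero] at hsymm
  rw [div_eq_inv_mul, mul_smul, hsymm, inv_smul_smul₀ hl]

omit hv hℓv in
theorem map_principal (hν : IsUnitNormal D ν) (hℓ : ∀ v, ⟪D v, D η⟫ = 0 → ℓ v = 0) :
    R η = (2 * l) • ν := by
  refine sub_eq_zero.1 (hν.eq_zero ?_ fun w => ?_)
  · rw [inner_sub_left, real_inner_smul_left, h.inner_normal, hη, hν.inner_self, sub_self]
  · have hw : ⟪D (w - ⟪D w, D η⟫ • η), D η⟫ = 0 := by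
      rw [map_sub, map_smul, inner_sub_left, real_inner_smul_left, hη, mul_one, sub_self]
    have hRw := h.inner_map_principal hη hl hw (hℓ _ hw)
    rw [map_sub, map_smul, inner_sub_left, real_inner_smul_left, real_inner_comm (R η) (D η),
      h.inner_principal, mul_zero, sub_zero] at hRw
    rw [inner_sub_left, real_inner_smul_left, real_inner_comm, hRw, real_inner_comm,
      hν.inner_eq_zero, mul_zero, sub_zero]

omit hv hℓv in
theorem apply_eq_and_map_eq [FiniteDimensional ℝ E] (hfin : 3 ≤ Module.finrank ℝ E)
    (hD : Function.Injective D) (hν : IsUnitNormal D ν) (v : E) :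
    ℓ v = ℓ η * ⟪D v, D η⟫ ∧
      R v = (ℓ η / l) • (D v - ⟪D v, D η⟫ • D η) + (2 * l * ⟪D v, D η⟫) • ν := by
  have hℓ : ∀ w, ⟪D w, D η⟫ = 0 → ℓ w = 0 := fun w => h.apply_eq_zero hfin hD
  have hperp : ⟪D (v - ⟪D v, D η⟫ • η), D η⟫ = 0 := by
    rw [map_sub, map_smul, inner_sub_left, real_inner_smul_left, hη, mul_one, sub_self]
  constructor
  · have hzero := hℓ _ hperp
    rw [map_sub, map_smul, smul_eq_mul] at hzero
    linarith
  · have hmap := h.map_eq_smul hη hl hperp (hℓ _ hperp)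
    rw [map_sub, map_smul, h.map_principal hη hl hν hℓ, map_sub, map_smul,
      sub_eq_iff_eq_add] at hmap
    rw [hmap, smul_smul, mul_comm ⟪D v, D η⟫]

end IsCodazzi

end Codazzi

/-! ### The structure equations of an ideal hypersurface -/

section StructureEquations

variable {n : ℕ} {X : 𝔼 n → 𝔼 (n + 1)} {V : Set (𝔼 n)} {N : 𝔼 n → 𝔼 (n + 1)} {y : 𝔼 n}
  {η : 𝔼 n → 𝔼 n}

/-- The principal direction `η` of an ideal hypersurface, as a field `ξ` of ambient vectors. -/
def principalField (X : 𝔼 n → 𝔼 (n + 1)) (η : 𝔼 n → 𝔼 n) (z : 𝔼 n) : 𝔼 (n + 1) :=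
  fderiv ℝ X z (η z)

/-- The one-form `θ` metrically dual to the principal direction. -/
def principalForm (X : 𝔼 n → 𝔼 (n + 1)) (η : 𝔼 n → 𝔼 n) (v z : 𝔼 n) : ℝ :=
  ⟪fderiv ℝ X z v, principalField X η z⟫

/-- The derivative `μ` of the principal curvature `λ` in the principal direction. -/
def principalSlope (X N : 𝔼 n → 𝔼 (n + 1)) (η : 𝔼 n → 𝔼 n) (z : 𝔼 n) : ℝ :=
  fderiv ℝ (idealCurvature X N) z (η z)

/-- The field `λ² ξ + μ N`, which turns out to be a constant multiple of the axis of rotation. -/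
def axisField (X N : 𝔼 n → 𝔼 (n + 1)) (η : 𝔼 n → 𝔼 n) (z : 𝔼 n) : 𝔼 (n + 1) :=
  idealCurvature X N z ^ 2 • principalField X η z + principalSlope X N η z • N z

local notation "κ" => idealCurvature X N
local notation "ξ" => principalField X η
local notation "θ" => principalForm X η
local notation "μ" => principalSlope X N η

theorem IsOrientedHypersurface.mul_inner_hess_eq_of_fderiv_eq_smul
    (h : IsOrientedHypersurface X V N) (hy : y ∈ V) {f : 𝔼 n → 𝔼 (n + 1)}
    (hf : ContDiffAt ℝ ∞ f y) {a : 𝔼 n → 𝔼 n → ℝ}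
    (hfa : ∀ z ∈ V, ∀ v, fderiv ℝ f z v = a z v • N z) (u v w : 𝔼 n) :
    a y v * ⟪hess X y u w, N y⟫ = a y u * ⟪hess X y v w, N y⟫ := by
  have hess_f : ∀ u v, ⟪hess f y u v, fderiv ℝ X y w⟫ = -(a y v * ⟪hess X y u w, N y⟫) :=
      fun u v => by
    have hX := h.contDiffAt y hy
    rw [← fderiv_fderiv_apply hf, inner_fderiv_of_inner_eq_const
      (g := fun z => fderiv ℝ X z w) (c := 0)
      ((contDiffAt_fderiv_apply hf v).differentiableAt (by simp))
      ((contDiffAt_fderiv_apply hX w).differentiableAt (by simp)) ?_, fderiv_fderiv_apply hX,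
      hfa y hy, real_inner_smul_left, real_inner_comm]
    filter_upwards [h.isOpen.mem_nhds hy] with z hz
    rw [hfa z hz, real_inner_smul_left, real_inner_comm, (h.isUnitNormal z hz).inner_eq_zero,
      mul_zero]
  have hsymm := hess_f u v
  rw [hess_symm hf, hess_f] at hsymm
  linarith

namespace IsIdealHypersurface

variable (h : IsIdealHypersurface X V N η) (hy : y ∈ V)
include h hy

theorem contDiffAt_principalField : ContDiffAt ℝ ∞ ξ y :=
  ((h.contDiffAt y hy).fderiv_right (by simp)).clm_apply (h.contDiffAt_eta y hy)

theorem contDiffAt_principalForm (v : 𝔼 n) : ContDiffAt ℝ ∞ (θ v) y :=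
  (contDiffAt_fderiv_apply (h.contDiffAt y hy) v).inner ℝ (h.contDiffAt_principalField hy)

theorem contDiffAt_principalSlope : ContDiffAt ℝ ∞ μ y :=
  ((h.contDiffAt_idealCurvature hy).fderiv_right (by simp)).clm_apply (h.contDiffAt_eta y hy)

theorem contDiffAt_axisField : ContDiffAt ℝ ∞ (axisField X N η) y :=
  (((h.contDiffAt_idealCurvature hy).pow 2).smul (h.contDiffAt_principalField hy)).add
    ((h.contDiffAt_principalSlope hy).smul (h.contDiffAt_normal y hy))

theorem hasFDerivAt_normal : HasFDerivAt N (fderiv ℝ N y) y :=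
  ((h.contDiffAt_normal y hy).differentiableAt (by simp)).hasFDerivAt

theorem hasFDerivAt_idealCurvature : HasFDerivAt κ (fderiv ℝ κ y) y :=
  ((h.contDiffAt_idealCurvature hy).differentiableAt (by simp)).hasFDerivAt

theorem hasFDerivAt_principalField : HasFDerivAt ξ (fderiv ℝ ξ y) y :=
  ((h.contDiffAt_principalField hy).differentiableAt (by simp)).hasFDerivAt

theorem hasFDerivAt_principalForm (v : 𝔼 n) : HasFDerivAt (θ v) (fderiv ℝ (θ v) y) y :=
  ((h.contDiffAt_principalForm hy v).differentiableAt (by simp)).hasFDerivAt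

theorem hasFDerivAt_principalSlope : HasFDerivAt μ (fderiv ℝ μ y) y :=
  ((h.contDiffAt_principalSlope hy).differentiableAt (by simp)).hasFDerivAt

theorem inner_principalField_self : ⟪ξ y, ξ y⟫ = 1 := (h.isIdealShape y hy).inner_self

theorem fderiv_normal (v : 𝔼 n) :
    fderiv ℝ N y v = -κ y • (fderiv ℝ X y v + θ v y • ξ y) := (h.isIdealShape y hy).map_eq v

theorem inner_fderiv_principalField_self (v : 𝔼 n) : ⟪fderiv ℝ ξ y v, ξ y⟫ = 0 := by
  have hξ := (h.contDiffAt_principalField hy).differentiableAt (by simp)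
  have hself := inner_fderiv_of_inner_eq_const (c := 1) hξ hξ (by
    filter_upwards [h.isOpen.mem_nhds hy] with z hz
    exact h.inner_principalField_self hz) v
  rw [real_inner_comm] at hself ⊢
  linarith

theorem inner_fderiv_principalField_normal (v : 𝔼 n) :
    ⟪fderiv ℝ ξ y v, N y⟫ = 2 * κ y * θ v y := by
  rw [inner_fderiv_of_inner_eq_const (c := 0)
    (h.hasFDerivAt_principalField hy).differentiableAt (h.hasFDerivAt_normal hy).differentiableAt
    (by
      filter_upwards [h.isOpen.mem_nhds hy] with z hz
      exact (h.isUnitNormal z hz).inner_eq_zero _), h.fderiv_normal hy, real_inner_smul_right,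
    inner_add_right, real_inner_smul_right, h.inner_principalField_self hy, real_inner_comm]
  change -(-κ y * (θ v y + θ v y * 1)) = 2 * κ y * θ v y
  ring

theorem fderiv_principalForm (u v : 𝔼 n) :
    fderiv ℝ (θ v) y u = ⟪hess X y u v, ξ y⟫ + ⟪fderiv ℝ X y v, fderiv ℝ ξ y u⟫ := by
  have hX := h.contDiffAt y hy
  unfold principalForm
  rw [fderiv_inner_apply ℝ ((contDiffAt_fderiv_apply hX v).differentiableAt (by simp))
    (h.hasFDerivAt_principalField hy).differentiableAt u, fderiv_fderiv_apply hX, add_comm]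

theorem hess_normal (u v : 𝔼 n) :
    hess N y u v
      = -κ y • (hess X y u v + (θ v y • fderiv ℝ ξ y u + fderiv ℝ (θ v) y u • ξ y))
        - fderiv ℝ κ y u • (fderiv ℝ X y v + θ v y • ξ y) := by
  have hX := h.contDiffAt y hy
  have hev : (fun z => fderiv ℝ N z v) =ᶠ[𝓝 y]
      fun z => -κ z • (fderiv ℝ X z v + θ v z • ξ z) := by
    filter_upwards [h.isOpen.mem_nhds hy] with z hz
    exact h.fderiv_normal hz v
  have hderiv := (h.hasFDerivAt_idealCurvature hy).fun_neg.fun_smul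
    (((contDiffAt_fderiv_apply hX v).differentiableAt (by simp)).hasFDerivAt.fun_add
      ((h.hasFDerivAt_principalForm hy v).fun_smul (h.hasFDerivAt_principalField hy)))
  rw [← fderiv_fderiv_apply (h.contDiffAt_normal y hy), hev.fderiv_eq, hderiv.fderiv]
  simp only [add_apply, smul_apply, neg_apply, ContinuousLinearMap.smulRight_apply,
    fderiv_fderiv_apply hX]
  module

theorem isCodazzi :
    IsCodazzi (fderiv ℝ X y) (fderiv ℝ ξ y) (N y) (η y) (fderiv ℝ κ y) (κ y) where
  inner_principal := h.inner_fderiv_principalField_self hy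
  inner_normal := h.inner_fderiv_principalField_normal hy
  symm u v := by
    have hsymm := hess_symm (h.contDiffAt_normal y hy) u v
    rw [h.hess_normal hy, h.hess_normal hy, h.fderiv_principalForm hy, h.fderiv_principalForm hy,
      hess_symm (h.contDiffAt y hy) v u] at hsymm
    change _ • (_ + θ v y • ξ y) + _ • (_ • ξ y + θ v y • _) =
      _ • (_ + θ u y • ξ y) + _ • (_ • ξ y + θ u y • _)
    rw [← sub_eq_zero, ← neg_eq_zero, ← sub_eq_zero.2 hsymm]
    module

variable (hn : 3 ≤ n)
include hn

theorem fderiv_idealCurvature_and_fderiv_principalField (v : 𝔼 n) :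
    fderiv ℝ κ y v = μ y * θ v y ∧
      fderiv ℝ ξ y v
        = (μ y / κ y) • (fderiv ℝ X y v - θ v y • ξ y) + (2 * κ y * θ v y) • N y :=
  (h.isCodazzi hy).apply_eq_and_map_eq (h.inner_principalField_self hy)
    (h.idealCurvature_pos y hy).ne' (by simpa using hn) (h.injective y hy) (h.isUnitNormal y hy) v

theorem fderiv_idealCurvature (v : 𝔼 n) : fderiv ℝ κ y v = μ y * θ v y :=
  (h.fderiv_idealCurvature_and_fderiv_principalField hy hn v).1

theorem fderiv_principalField (v : 𝔼 n) :
    fderiv ℝ ξ y v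
      = (μ y / κ y) • (fderiv ℝ X y v - θ v y • ξ y) + (2 * κ y * θ v y) • N y :=
  (h.fderiv_idealCurvature_and_fderiv_principalField hy hn v).2

theorem inner_fderiv_fderiv_principalField (u v : 𝔼 n) :
    ⟪fderiv ℝ X y v, fderiv ℝ ξ y u⟫
      = μ y / κ y * (⟪fderiv ℝ X y v, fderiv ℝ X y u⟫ - θ u y * θ v y) := by
  rw [h.fderiv_principalField hy hn, inner_add_right, real_inner_smul_right, real_inner_smul_right,
    (h.isUnitNormal y hy).inner_eq_zero, inner_sub_right, real_inner_smul_right, mul_zero, add_zero]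
  rfl

theorem hess_idealCurvature (u v : 𝔼 n) :
    hess κ y u v
      = μ y * (⟪hess X y u v, ξ y⟫
          + μ y / κ y * (⟪fderiv ℝ X y v, fderiv ℝ X y u⟫ - θ u y * θ v y))
        + θ v y * fderiv ℝ μ y u := by
  have hev : (fun z => fderiv ℝ κ z v) =ᶠ[𝓝 y] fun z => μ z * θ v z := by
    filter_upwards [h.isOpen.mem_nhds hy] with z hz
    exact h.fderiv_idealCurvature hz hn v
  have hderiv := (h.hasFDerivAt_principalSlope hy).fun_mul (h.hasFDerivAt_principalForm hy v)
  rw [← fderiv_fderiv_apply (h.contDiffAt_idealCurvature hy), hev.fderiv_eq, hderiv.fderiv,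
    ← h.inner_fderiv_fderiv_principalField hy hn, ← h.fderiv_principalForm hy]
  simp only [add_apply, smul_apply, smul_eq_mul]

theorem fderiv_principalSlope_eq_mul (v : 𝔼 n) :
    fderiv ℝ μ y v = fderiv ℝ μ y (η y) * θ v y := by
  have hη : θ (η y) y = 1 := h.inner_principalField_self hy
  have hsymm := hess_symm (h.contDiffAt_idealCurvature hy) (η y) v
  rw [h.hess_idealCurvature hy hn, h.hess_idealCurvature hy hn, hess_symm (h.contDiffAt y hy) v, hη,
    real_inner_comm (fderiv ℝ X y v)] at hsymm
  linear_combination -hsymm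

theorem fderiv_axisField_eq_smul (v : 𝔼 n) :
    fderiv ℝ (axisField X N η) y v
      = ((2 * κ y ^ 3 + fderiv ℝ μ y (η y)) * θ v y) • N y := by
  have hderiv := (((h.hasFDerivAt_idealCurvature hy).pow 2).smul
    (h.hasFDerivAt_principalField hy)).add
    ((h.hasFDerivAt_principalSlope hy).smul (h.hasFDerivAt_normal hy))
  have hκ : κ y ≠ 0 := (h.idealCurvature_pos y hy).ne'
  change fderiv ℝ ((fun z => κ z ^ 2) • ξ + μ • N) y v = _
  rw [hderiv.fderiv]
  simp only [add_apply, smul_apply, ContinuousLinearMap.smulRight_apply,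
    h.fderiv_principalField hy hn, h.fderiv_normal hy, h.fderiv_idealCurvature hy hn,
    h.fderiv_principalSlope_eq_mul hy hn v]
  match_scalars <;>
    simp only [mul_one, mul_neg, Nat.add_one_sub_one, pow_one, nsmul_eq_mul, Nat.cast_ofNat,
      smul_eq_mul, neg_mul] <;>
    field_simp [hκ] <;> ring

theorem fderiv_principalSlope_principal : fderiv ℝ μ y (η y) = -2 * κ y ^ 3 := by
  obtain ⟨v, hv, hvξ⟩ := exists_norm_map_eq_one_inner_eq_zero (h.injective y hy)
    (fun _ : Unit => ξ y) (by simpa using (by lia : 1 < n))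
  have hθη : θ (η y) y = 1 := h.inner_principalField_self hy
  have hθv : θ v y = 0 := hvξ ()
  have hess_v : ⟪hess X y v v, N y⟫ = κ y := by
    rw [← neg_neg ⟪_, _⟫, ← h.inner_fderiv_normal_fderiv hy, h.fderiv_normal hy, hθv, zero_smul,
      add_zero, real_inner_smul_left, real_inner_self_eq_norm_sq, hv]
    ring
  have hsymm := h.mul_inner_hess_eq_of_fderiv_eq_smul hy (h.contDiffAt_axisField hy)
    (fun z hz => h.fderiv_axisField_eq_smul hz hn) v (η y) v
  rw [hθη, hθv, hess_v, mul_zero, zero_mul, mul_one] at hsymm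
  linarith [(mul_eq_zero.1 hsymm).resolve_right (h.idealCurvature_pos y hy).ne']

theorem fderiv_principalSlope (v : 𝔼 n) : fderiv ℝ μ y v = -2 * κ y ^ 3 * θ v y := by
  rw [h.fderiv_principalSlope_eq_mul hy hn, h.fderiv_principalSlope_principal hy hn]

theorem fderiv_axisField : fderiv ℝ (axisField X N η) y = 0 := by
  ext1 v
  rw [h.fderiv_axisField_eq_smul hy hn, h.fderiv_principalSlope_principal hy hn, neg_mul,
    add_neg_cancel, zero_mul, zero_smul, zero_apply]

end IsIdealHypersurface

end StructureEquations

/-! ### The invariants of an ideal hypersurface -/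

/-- The invariants `a`, `E` and `C` of an ideal hypersurface, determined at a point `x` by the unit
normal `ν`, the principal vector `ξ`, the principal curvature `λ = l` and its slope `μ = m`: on
`sdHypersurface` these are the modulus `a`, the direction of the axis and the vertex on the
axis. -/
structure HasInvariants {F : Type*} [AddCommGroup F] [Module ℝ F] (a : ℝ) (E C x ν ξ : F)
    (l m : ℝ) : Prop where
  energy : m ^ 2 + l ^ 4 = a ^ 4 / 4
  axis : (2 / a ^ 2) • (l ^ 2 • ξ + m • ν) = E
  center : x - (4 / a ^ 4) • ((l * m) • ξ - l ^ 3 • ν) - heightOfSlope a (2 / a ^ 2 * m) • E = C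

theorem slope_sq_add {a l m : ℝ} (ha : 0 < a) (h : m ^ 2 + l ^ 4 = a ^ 4 / 4) :
    (2 / a ^ 2 * m) ^ 2 + (2 * l / a) ^ 4 / 4 = 1 := by
  field_simp
  linear_combination 16 * h

theorem slope_mem_Ioo {a l m : ℝ} (ha : 0 < a) (hl : 0 < l) (h : m ^ 2 + l ^ 4 = a ^ 4 / 4) :
    2 / a ^ 2 * m ∈ Ioo (-1 : ℝ) 1 := by
  have hsq := slope_sq_add ha h
  have hpos : 0 < (2 * l / a) ^ 4 / 4 := by positivity
  exact abs_lt.1 ((sq_lt_one_iff_abs_lt_one _).1 (by linarith))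

section Invariants

variable {n : ℕ} {X : 𝔼 n → 𝔼 (n + 1)} {V : Set (𝔼 n)} {N : 𝔼 n → 𝔼 (n + 1)} {y z : 𝔼 n}
  {η : 𝔼 n → 𝔼 n}

local notation "κ" => idealCurvature X N
local notation "ξ" => principalField X η
local notation "θ" => principalForm X η
local notation "μ" => principalSlope X N η

namespace IsIdealHypersurface

section

variable (h : IsIdealHypersurface X V N η) (hn : 3 ≤ n) (hy : y ∈ V)
include h hn hy

theorem hasFDerivAt_energy : HasFDerivAt (fun y => μ y ^ 2 + κ y ^ 4) (0 : 𝔼 n →L[ℝ] ℝ) y := by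
  refine (((h.hasFDerivAt_principalSlope hy).pow 2).add
    ((h.hasFDerivAt_idealCurvature hy).pow 4)).congr_fderiv ?_
  ext1 v
  simp only [add_apply, smul_apply, h.fderiv_idealCurvature hy hn, h.fderiv_principalSlope hy hn,
    zero_apply, smul_eq_mul, nsmul_eq_mul]
  push_cast
  ring

theorem hasFDerivAt_axisField : HasFDerivAt (axisField X N η) (0 : 𝔼 n →L[ℝ] 𝔼 (n + 1)) y :=
  h.fderiv_axisField hy hn ▸ ((h.contDiffAt_axisField hy).differentiableAt (by simp)).hasFDerivAt

omit hn in
theorem hasFDerivAt_heightOfSlope {a : ℝ} (ha : 0 < a) (hen : μ y ^ 2 + κ y ^ 4 = a ^ 4 / 4) :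
    HasFDerivAt (fun z => heightOfSlope a (2 / a ^ 2 * μ z))
      (-(1 / (2 * κ y)) • (2 / a ^ 2) • fderiv ℝ μ y) y := by
  have hκ := h.idealCurvature_pos y hy
  have hσ := hasDerivAt_heightOfSlope ha (by positivity) (slope_mem_Ioo ha hκ hen)
    (slope_sq_add ha hen)
  rw [mul_div_cancel₀ _ ha.ne'] at hσ
  exact HasDerivAt.comp_hasFDerivAt (h₂ := heightOfSlope a) y hσ
    ((h.hasFDerivAt_principalSlope hy).const_mul (2 / a ^ 2))

theorem hasFDerivAt_center {a : ℝ} (ha : 0 < a) (hen : μ y ^ 2 + κ y ^ 4 = a ^ 4 / 4)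
    {E : 𝔼 (n + 1)} (hE : (2 / a ^ 2) • axisField X N η y = E) :
    HasFDerivAt (fun z => X z - (4 / a ^ 4) • ((κ z * μ z) • ξ z - κ z ^ 3 • N z)
      - heightOfSlope a (2 / a ^ 2 * μ z) • E) (0 : 𝔼 n →L[ℝ] 𝔼 (n + 1)) y := by
  have hκ := (h.idealCurvature_pos y hy).ne'
  have hX := ((h.contDiffAt y hy).differentiableAt (by simp)).hasFDerivAt
  have hderiv := (hX.sub (((((h.hasFDerivAt_idealCurvature hy).mul
    (h.hasFDerivAt_principalSlope hy)).smul (h.hasFDerivAt_principalField hy)).sub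
      (((h.hasFDerivAt_idealCurvature hy).pow 3).smul
        (h.hasFDerivAt_normal hy))).const_smul (4 / a ^ 4))).sub
    ((h.hasFDerivAt_heightOfSlope hy ha hen).smul_const E)
  refine hderiv.congr_fderiv (ContinuousLinearMap.ext fun v => ?_)
  rw [← hE]
  simp only [add_apply, sub_apply, smul_apply, ContinuousLinearMap.smulRight_apply,
    h.fderiv_principalField hy hn, h.fderiv_normal hy, h.fderiv_idealCurvature hy hn,
    h.fderiv_principalSlope hy hn, zero_apply, axisField, Pi.mul_apply, nsmul_eq_mul, smul_eq_mul]
  have hμ : μ y ^ 2 = a ^ 4 / 4 - κ y ^ 4 := eq_sub_of_add_eq hen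
  match_scalars
  · simp only [mul_one, mul_neg, sub_neg_eq_add]
    field_simp
    linear_combination (-4 : ℝ) * hμ
  · simp only [mul_one, mul_neg, neg_mul, sub_neg_eq_add, one_div, mul_inv_rev, neg_neg]
    field_simp
    ring
  · simp only [mul_one, Nat.add_one_sub_one, one_div, mul_inv_rev, neg_mul, mul_neg, neg_neg]
    field_simp
    ring

end

theorem hasInvariants_of_hasInvariants (h : IsIdealHypersurface X V N η) (hn : 3 ≤ n)
    (hV : IsPreconnected V) {a : ℝ} (ha : 0 < a) {E C : 𝔼 (n + 1)} (hy : y ∈ V) (hz : z ∈ V)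
    (hI : HasInvariants a E C (X y) (N y) (ξ y) (κ y) (μ y)) :
    HasInvariants a E C (X z) (N z) (ξ z) (κ z) (μ z) := by
  have eq_of_hasFDerivAt : ∀ {G : Type} [NormedAddCommGroup G] [NormedSpace ℝ G] {f : 𝔼 n → G},
      (∀ w ∈ V, HasFDerivAt f (0 : 𝔼 n →L[ℝ] G) w) → ∀ w ∈ V, f w = f y := fun hf w hw =>
    h.isOpen.is_const_of_fderiv_eq_zero hV
      (fun w hw => (hf w hw).differentiableAt.differentiableWithinAt)
      (fun w hw => (hf w hw).fderiv) hw hy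
  have henergy : ∀ w ∈ V, μ w ^ 2 + κ w ^ 4 = a ^ 4 / 4 := fun w hw =>
    (eq_of_hasFDerivAt (fun _ => h.hasFDerivAt_energy hn) w hw).trans hI.energy
  have haxis : ∀ w ∈ V, (2 / a ^ 2) • axisField X N η w = E := fun w hw => by
    rw [eq_of_hasFDerivAt (fun _ => h.hasFDerivAt_axisField hn) w hw]
    exact hI.axis
  exact ⟨henergy z hz, haxis z hz, (eq_of_hasFDerivAt (fun w hw =>
    h.hasFDerivAt_center hn hw ha (henergy w hw) (haxis w hw)) z hz).trans hI.center⟩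

end IsIdealHypersurface

/-- A continuous function which bounds `μ² / λ` on an ideal hypersurface. Unlike `μ` and `ξ`, it
is defined also where `λ` vanishes. -/
def slopeBound (X N : 𝔼 n → 𝔼 (n + 1)) (y : 𝔼 n) : ℝ :=
  ‖hess (idealCurvature X N) y‖ * ‖leftInv (fderiv ℝ X y)‖ ^ 2
    + ‖fderiv ℝ (idealCurvature X N) y‖ * ‖leftInv (fderiv ℝ X y)‖
      * (‖hess X y‖ * ‖leftInv (fderiv ℝ X y)‖ ^ 2)

theorem continuousAt_norm_hess {F : Type*} [NormedAddCommGroup F] [NormedSpace ℝ F] {f : 𝔼 n → F}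
    (hf : ContDiffAt ℝ ∞ f y) : ContinuousAt (fun z => ‖hess f z‖) y :=
  ContinuousAt.norm (E := 𝔼 n →L[ℝ] 𝔼 n →L[ℝ] F) (contDiffAt_hess hf).continuousAt

theorem IsOrientedHypersurface.continuousAt_slopeBound (h : IsOrientedHypersurface X V N)
    (hy : y ∈ V) : ContinuousAt (slopeBound X N) y := by
  have hκ := h.contDiffAt_idealCurvature hy
  have hfderiv : ContinuousAt (fderiv ℝ κ) y :=
    (hκ.fderiv_right (m := ∞) (by simp)).continuousAt
  have hleft := (h.contDiffAt_leftInv_fderiv hy).continuousAt.norm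
  exact ((continuousAt_norm_hess hκ).mul (hleft.pow 2)).add
    ((hfderiv.norm.mul hleft).mul
      ((continuousAt_norm_hess (h.contDiffAt y hy)).mul (hleft.pow 2)))

theorem idealCurvature_neg (X N : 𝔼 n → 𝔼 (n + 1)) :
    idealCurvature X (-N) = -idealCurvature X N := by
  ext y
  have hneg : (leftInv (fderiv ℝ X y) ∘L (-fderiv ℝ N y)).toLinearMap
      = -(leftInv (fderiv ℝ X y) ∘L fderiv ℝ N y).toLinearMap := by
    rw [ContinuousLinearMap.comp_neg]
    rfl
  rw [Pi.neg_apply, idealCurvature, idealCurvature, fderiv_neg, hneg, map_neg, mul_neg]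

theorem IsOrientedIdealHypersurface.neg (h : IsOrientedIdealHypersurface X V N) :
    IsOrientedIdealHypersurface X V (-N) where
  toIsOrientedHypersurface := h.toIsOrientedHypersurface.neg
  exists_isIdealShape y hy := by
    obtain ⟨η, hη⟩ := h.exists_isIdealShape y hy
    rw [idealCurvature_neg, fderiv_neg]
    exact ⟨η, hη.neg⟩

theorem IsOrientedIdealHypersurface.exists_isIdealHypersurface_of_ne_zero
    (h : IsOrientedIdealHypersurface X V N) (hy : y ∈ V) (h0 : κ y ≠ 0) :
    ∃ V', y ∈ V' ∧ ∃ N', (N' = N ∨ N' = -N) ∧ ∃ η, IsIdealHypersurface X V' N' η := by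
  rcases h0.lt_or_gt with hneg | hpos
  · obtain ⟨V', hyV', η, hη⟩ := h.neg.exists_isIdealHypersurface hy
      (by rw [idealCurvature_neg]; exact neg_pos.2 hneg)
    exact ⟨V', hyV', -N, .inr rfl, η, hη⟩
  · obtain ⟨V', hyV', η, hη⟩ := h.exists_isIdealHypersurface hy hpos
    exact ⟨V', hyV', N, .inl rfl, η, hη⟩

theorem slopeBound_neg (X N : 𝔼 n → 𝔼 (n + 1)) : slopeBound X (-N) = slopeBound X N := by
  have hfderiv : fderiv ℝ (-idealCurvature X N) = -fderiv ℝ (idealCurvature X N) :=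
    funext fun _ => fderiv_neg
  ext y
  have hhess : ‖hess (-idealCurvature X N) y‖ = ‖hess (idealCurvature X N) y‖ := by
    rw [hess, hfderiv, fderiv_neg]
    exact norm_neg (hess (idealCurvature X N) y)
  rw [slopeBound, slopeBound, idealCurvature_neg, hhess, hfderiv, Pi.neg_apply, norm_neg]

theorem norm_le_norm_leftInv {E F : Type*} [NormedAddCommGroup E] [InnerProductSpace ℝ E]
    [FiniteDimensional ℝ E] [NormedAddCommGroup F] [InnerProductSpace ℝ F]
    [FiniteDimensional ℝ F] {D : E →L[ℝ] F} (hD : Function.Injective D) {v : E} (hv : ‖D v‖ = 1) :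
    ‖v‖ ≤ ‖leftInv D‖ := by
  simpa only [leftInv_map hD, hv, mul_one] using (leftInv D).le_opNorm (D v)

theorem norm_hess_le {F : Type*} [NormedAddCommGroup F] [NormedSpace ℝ F] (f : 𝔼 n → F)
    (y : 𝔼 n) {v : 𝔼 n} {c : ℝ} (hv : ‖v‖ ≤ c) : ‖hess f y v v‖ ≤ ‖hess f y‖ * c ^ 2 := by
  refine (ContinuousLinearMap.le_opNorm₂ _ v v).trans ?_
  rw [mul_assoc, ← sq]
  gcongr

theorem IsIdealHypersurface.principalSlope_sq_le (h : IsIdealHypersurface X V N η) (hn : 3 ≤ n)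
    (hy : y ∈ V) : μ y ^ 2 ≤ κ y * slopeBound X N y := by
  have hX := h.injective y hy
  have hξ : ‖ξ y‖ = 1 := (h.isIdealShape y hy).norm_eq
  have hκ := h.idealCurvature_pos y hy
  obtain ⟨v, hv, hvξ⟩ := exists_norm_map_eq_one_inner_eq_zero hX (fun _ : Unit => ξ y)
    (by simpa using (by lia : 1 < n))
  have hv_le := norm_le_norm_leftInv hX hv
  have hθ : θ v y = 0 := hvξ ()
  have hess_v := h.hess_idealCurvature hy hn v v
  rw [hθ, real_inner_self_eq_norm_sq, hv] at hess_v
  have heq : μ y ^ 2 = κ y * (hess κ y v v - μ y * ⟪hess X y v v, ξ y⟫) := by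
    rw [hess_v]
    field_simp
    ring
  have hμ : |μ y| ≤ ‖fderiv ℝ κ y‖ * ‖leftInv (fderiv ℝ X y)‖ :=
    ((fderiv ℝ κ y).le_opNorm (η y)).trans
      (mul_le_mul_of_nonneg_left (norm_le_norm_leftInv hX hξ) (norm_nonneg _))
  have hinner : |⟪hess X y v v, ξ y⟫| ≤ ‖hess X y‖ * ‖leftInv (fderiv ℝ X y)‖ ^ 2 := by
    refine (abs_real_inner_le_norm _ _).trans ?_
    rw [hξ, mul_one]
    exact norm_hess_le X y hv_le
  have hmul := mul_le_mul hμ hinner (abs_nonneg _) (by positivity)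
  rw [← abs_mul] at hmul
  have hhess := (Real.le_norm_self _).trans (norm_hess_le κ y hv_le)
  rw [heq, slopeBound]
  gcongr
  linarith [neg_abs_le (μ y * ⟪hess X y v v, ξ y⟫)]

end Invariants

/-! ### The invariants on the manifold -/

theorem eventuallyEq_or_eventuallyEq_neg {M F : Type*} [TopologicalSpace M] [NormedAddCommGroup F]
    [NormedSpace ℝ F] {f g : M → F} {p : M} (hf : ContinuousAt f p) (hg : ContinuousAt g p)
    (h0 : f p ≠ 0) (h : ∀ᶠ q in 𝓝 p, g q = f q ∨ g q = -f q) :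
    g =ᶠ[𝓝 p] f ∨ g =ᶠ[𝓝 p] -f := by
  have h2 : f p + f p ≠ 0 := by
    rw [← two_smul ℝ]
    exact smul_ne_zero two_ne_zero h0
  rcases h.self_of_nhds with hp | hp
  · left
    filter_upwards [h, (hg.add hf).eventually_ne (show g p + f p ≠ 0 by rwa [hp])] with q hq hne
    exact hq.resolve_right fun hq => hne (by rw [Pi.add_apply, hq, neg_add_cancel])
  · right
    filter_upwards [h, (hf.sub hg).eventually_ne (show f p - g p ≠ 0 by rwa [hp, sub_neg_eq_add])]
      with q hq hne
    exact hq.resolve_left fun hq => hne (by rw [Pi.sub_apply, hq, sub_self])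

section Precomposition

variable {E E' F : Type*} [NormedAddCommGroup E] [InnerProductSpace ℝ E] [NormedAddCommGroup E']
  [InnerProductSpace ℝ E'] [NormedAddCommGroup F] [InnerProductSpace ℝ F] {D A : E →L[ℝ] F}
  {T : E' →L[ℝ] E}

theorem IsUnitNormal.comp {ν : F} (h : IsUnitNormal D ν) (hT : Function.Surjective T) :
    IsUnitNormal (D ∘L T) ν where
  norm_eq := h.norm_eq
  range_eq := (LinearMap.range_comp_of_range_eq_top D.toLinearMap
    (LinearMap.range_eq_top.2 hT)).trans h.range_eq

theorem isIdealShape_comp_iff (hT : Function.Surjective T) {l : ℝ} {η : E'} :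
    IsIdealShape (D ∘L T) (A ∘L T) l η ↔ IsIdealShape D A l (T η) :=
  ⟨fun h => ⟨h.norm_eq, hT.forall.2 h.map_eq⟩, fun h => ⟨h.norm_eq, fun v => h.map_eq (T v)⟩⟩

end Precomposition

section Manifold

variable {n : ℕ} {M : Type*} [TopologicalSpace M] [ChartedSpace (𝔼 n) M]
  {F : Type*} [NormedAddCommGroup F] [NormedSpace ℝ F]

/-- The differential of a function on the manifold with values in a vector space. -/
def mdiff (n : ℕ) {M : Type*} [TopologicalSpace M] [ChartedSpace (𝔼 n) M] {F : Type*}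
    [NormedAddCommGroup F] [NormedSpace ℝ F] (f : M → F) (p : M) : 𝔼 n →L[ℝ] F :=
  mfderiv 𝓘(ℝ, 𝔼 n) 𝓘(ℝ, F) f p

/-- On the open set `W` of the manifold, `ν` is a unit normal field of the immersion `x` for which
the principal curvatures are `l, …, l, 2 l`. -/
structure IsIdealOrientation (x : M → 𝔼 (n + 1)) (W : Set M) (ν : M → 𝔼 (n + 1)) (l : M → ℝ) :
    Prop where
  isOpen : IsOpen W
  continuousOn_normal : ContinuousOn ν W
  isUnitNormal : ∀ p ∈ W, IsUnitNormal (mdiff n x p) (ν p)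
  exists_isIdealShape : ∀ p ∈ W, ∃ η, IsIdealShape (mdiff n x p) (mdiff n ν p) (l p) η

/-- The invariants `a`, `E` and `C` of the immersion `x` at the point `p`, computed with the unit
normal for which the principal curvatures are positive. -/
def HasInvariantsAt (x : M → 𝔼 (n + 1)) (a : ℝ) (E C : 𝔼 (n + 1)) (p : M) : Prop :=
  ∃ W ν l η, p ∈ W ∧ IsIdealOrientation x W ν l ∧ 0 < l p ∧
    IsIdealShape (mdiff n x p) (mdiff n ν p) (l p) η ∧
    HasInvariants a E C (x p) (ν p) (mdiff n x p η) (l p) (mdiff n l p η)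

variable {x : M → 𝔼 (n + 1)} {p q : M}

namespace IsIdealOrientation

variable {W W' : Set M} {ν ν' : M → 𝔼 (n + 1)} {l l' : M → ℝ}

theorem neg (h : IsIdealOrientation x W ν l) : IsIdealOrientation x W (-ν) (-l) where
  isOpen := h.isOpen
  continuousOn_normal := h.continuousOn_normal.neg
  isUnitNormal p hp := (h.isUnitNormal p hp).neg
  exists_isIdealShape p hp := by
    obtain ⟨η, hη⟩ := h.exists_isIdealShape p hp
    have hneg : mdiff n (-ν) p = -mdiff n ν p := mfderiv_neg
    exact ⟨η, hneg ▸ hη.neg⟩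

theorem curvature_eventuallyEq (hx : IsSmoothImmersion (n := n) x)
    (h : IsIdealOrientation x W ν l) (h' : IsIdealOrientation x W' ν' l') (hp : p ∈ W)
    (hp' : p ∈ W') (hν : ν' =ᶠ[𝓝 p] ν) : l' =ᶠ[𝓝 p] l := by
  filter_upwards [h.isOpen.mem_nhds hp, h'.isOpen.mem_nhds hp', hν.eventuallyEq_nhds]
    with q hq hq' hνq
  obtain ⟨η, hη⟩ := h.exists_isIdealShape q hq
  obtain ⟨η', hη'⟩ := h'.exists_isIdealShape q hq'
  have hmdiff : mdiff n ν' q = mdiff n ν q := hνq.mfderiv_eq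
  exact hη.curvature_unique (hmdiff ▸ hη') (hx.2 q)

theorem eventuallyEq_or_eventuallyEq_neg (hx : IsSmoothImmersion (n := n) x)
    (h : IsIdealOrientation x W ν l) (h' : IsIdealOrientation x W' ν' l') (hp : p ∈ W)
    (hp' : p ∈ W') :
    (ν' =ᶠ[𝓝 p] ν ∧ l' =ᶠ[𝓝 p] l) ∨ (ν' =ᶠ[𝓝 p] -ν ∧ l' =ᶠ[𝓝 p] -l) := by
  have hW := h.isOpen.mem_nhds hp
  have hW' := h'.isOpen.mem_nhds hp'
  have hsign : ∀ᶠ q in 𝓝 p, ν' q = ν q ∨ ν' q = -ν q := by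
    filter_upwards [hW, hW'] with q hq hq'
    exact (h.isUnitNormal q hq).eq_or_eq_neg (h'.isUnitNormal q hq')
  have hne : ν p ≠ 0 := norm_ne_zero_iff.1 ((h.isUnitNormal p hp).norm_eq ▸ one_ne_zero)
  exact (Casorati.eventuallyEq_or_eventuallyEq_neg (h.continuousOn_normal.continuousAt hW)
    (h'.continuousOn_normal.continuousAt hW') hne hsign).imp
      (fun hν => ⟨hν, h.curvature_eventuallyEq hx h' hp hp' hν⟩)
      fun hν => ⟨hν, h.neg.curvature_eventuallyEq hx h' hp hp' hν⟩

end IsIdealOrientation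

variable [IsManifold 𝓘(ℝ, 𝔼 n) ∞ M] {φ : OpenPartialHomeomorph M (𝔼 n)} {V : Set (𝔼 n)}
  {N : 𝔼 n → 𝔼 (n + 1)} {η : 𝔼 n → 𝔼 n} {a : ℝ} {E C : 𝔼 (n + 1)}

theorem mdiff_comp_chart (hφ : φ ∈ atlas (𝔼 n) M) (hp : p ∈ φ.source) {g : 𝔼 n → F}
    (hg : DifferentiableAt ℝ g (φ p)) : mdiff n (g ∘ φ) p = fderiv ℝ g (φ p) ∘L mdiff n φ p :=
  (hasMFDerivAt_of_eventuallyEq_comp_chart hφ hp hg EventuallyEq.rfl).mfderiv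

theorem mdiff_chart_surjective (hφ : φ ∈ atlas (𝔼 n) M) (hp : p ∈ φ.source) :
    Function.Surjective (mdiff n φ p) :=
  (mfderiv_chart_bijective hφ hp).2

theorem IsSmoothImmersion.mdiff_eq (hx : IsSmoothImmersion (n := n) x) (hφ : φ ∈ atlas (𝔼 n) M)
    (hp : p ∈ φ.source) : mdiff n x p = fderiv ℝ (x ∘ φ.symm) (φ p) ∘L mdiff n φ p :=
  hx.mfderiv_eq_comp_mfderiv_chart hφ hp

theorem IsOrientedIdealHypersurface.isIdealOrientation (hx : IsSmoothImmersion (n := n) x)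
    (hφ : φ ∈ atlas (𝔼 n) M) (h : IsOrientedIdealHypersurface (x ∘ φ.symm) V N) :
    IsIdealOrientation x (φ.source ∩ φ ⁻¹' V) (N ∘ φ) (idealCurvature (x ∘ φ.symm) N ∘ φ) where
  isOpen := φ.continuousOn.isOpen_inter_preimage φ.open_source h.isOpen
  continuousOn_normal p hp :=
    ((h.contDiffAt_normal _ hp.2).continuousAt.comp (φ.continuousAt hp.1)).continuousWithinAt
  isUnitNormal p hp := by
    rw [hx.mdiff_eq hφ hp.1]
    exact (h.isUnitNormal _ hp.2).comp (mdiff_chart_surjective hφ hp.1)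
  exists_isIdealShape p hp := by
    obtain ⟨η, hη⟩ := h.exists_isIdealShape _ hp.2
    obtain ⟨v, rfl⟩ := mdiff_chart_surjective hφ hp.1 η
    rw [hx.mdiff_eq hφ hp.1, mdiff_comp_chart hφ hp.1
      ((h.contDiffAt_normal _ hp.2).differentiableAt (by simp)), Function.comp_apply]
    exact ⟨v, (isIdealShape_comp_iff (mdiff_chart_surjective hφ hp.1)).2 hη⟩

namespace IsIdealHypersurface

theorem isIdealOrientation (hx : IsSmoothImmersion (n := n) x) (hφ : φ ∈ atlas (𝔼 n) M)
    (h : IsIdealHypersurface (x ∘ φ.symm) V N η) :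
    IsIdealOrientation x (φ.source ∩ φ ⁻¹' V) (N ∘ φ) (idealCurvature (x ∘ φ.symm) N ∘ φ) :=
  (IsOrientedIdealHypersurface.mk h.toIsOrientedHypersurface
    fun y hy => ⟨_, h.isIdealShape y hy⟩).isIdealOrientation hx hφ

theorem mdiff_idealCurvature (hφ : φ ∈ atlas (𝔼 n) M)
    (h : IsIdealHypersurface (x ∘ φ.symm) V N η) (hp : p ∈ φ.source) (hpV : φ p ∈ V) :
    mdiff n (idealCurvature (x ∘ φ.symm) N ∘ φ) p
      = fderiv ℝ (idealCurvature (x ∘ φ.symm) N) (φ p) ∘L mdiff n φ p :=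
  mdiff_comp_chart hφ hp ((h.contDiffAt_idealCurvature hpV).differentiableAt (by simp))

theorem hasInvariantsAt (hx : IsSmoothImmersion (n := n) x) (hφ : φ ∈ atlas (𝔼 n) M)
    (h : IsIdealHypersurface (x ∘ φ.symm) V N η) (hp : p ∈ φ.source) (hpV : φ p ∈ V)
    (hI : HasInvariants a E C ((x ∘ φ.symm) (φ p)) (N (φ p)) (principalField (x ∘ φ.symm) η (φ p))
      (idealCurvature (x ∘ φ.symm) N (φ p)) (principalSlope (x ∘ φ.symm) N η (φ p))) :
    HasInvariantsAt x a E C p := by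
  obtain ⟨v, hv⟩ := mdiff_chart_surjective hφ hp (η (φ p))
  refine ⟨φ.source ∩ φ ⁻¹' V, _, _, v, ⟨hp, hpV⟩, h.isIdealOrientation hx hφ,
    h.idealCurvature_pos _ hpV, ?_, ?_⟩
  · rw [hx.mdiff_eq hφ hp,
      mdiff_comp_chart hφ hp ((h.contDiffAt_normal _ hpV).differentiableAt (by simp)),
      isIdealShape_comp_iff (mdiff_chart_surjective hφ hp), hv]
    exact h.isIdealShape _ hpV
  · rw [h.mdiff_idealCurvature hφ hp hpV, hx.mdiff_eq hφ hp, ContinuousLinearMap.comp_apply,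
      ContinuousLinearMap.comp_apply, hv]
    rwa [Function.comp_apply, φ.left_inv hp] at hI

theorem exists_hasInvariants (hx : IsSmoothImmersion (n := n) x) (hφ : φ ∈ atlas (𝔼 n) M)
    (h : IsIdealHypersurface (x ∘ φ.symm) V N η) (hp : p ∈ φ.source) (hpV : φ p ∈ V)
    (hI : HasInvariantsAt x a E C p) : ∃ s : ℝ, s * s = 1 ∧
      HasInvariants a E C ((x ∘ φ.symm) (φ p)) (N (φ p))
        (principalField (x ∘ φ.symm) (s • η) (φ p)) (idealCurvature (x ∘ φ.symm) N (φ p))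
        (principalSlope (x ∘ φ.symm) N (s • η) (φ p)) := by
  obtain ⟨W, ν, l, v, hpW, hν, hl, hshape, hI⟩ := hI
  have hpos := h.idealCurvature_pos _ hpV
  obtain ⟨hν, hκ⟩ | ⟨-, hκ⟩ :=
    (h.isIdealOrientation hx hφ).eventuallyEq_or_eventuallyEq_neg hx hν ⟨hp, hpV⟩ hpW
  · have hmdiffν : mdiff n ν p = mdiff n (N ∘ φ) p := hν.mfderiv_eq
    have hmdiffl : mdiff n l p = mdiff n (idealCurvature (x ∘ φ.symm) N ∘ φ) p := hκ.mfderiv_eq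
    rw [hmdiffν, hx.mdiff_eq hφ hp,
      mdiff_comp_chart hφ hp ((h.contDiffAt_normal _ hpV).differentiableAt (by simp)),
      isIdealShape_comp_iff (mdiff_chart_surjective hφ hp)] at hshape
    obtain ⟨s, hs, hv⟩ := (h.isIdealShape _ hpV).exists_eq_smul hshape (h.injective _ hpV) hpos.ne'
    rw [hmdiffl, h.mdiff_idealCurvature hφ hp hpV, hx.mdiff_eq hφ hp, hκ.self_of_nhds,
      hν.self_of_nhds, ContinuousLinearMap.comp_apply, ContinuousLinearMap.comp_apply, hv] at hI
    refine ⟨s, hs, ?_⟩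
    rwa [Function.comp_apply, φ.left_inv hp]
  · have hneg := hκ.self_of_nhds
    rw [Pi.neg_apply, Function.comp_apply] at hneg
    linarith

theorem hasInvariantsAt_of_hasInvariantsAt (hn : 3 ≤ n) (hx : IsSmoothImmersion (n := n) x)
    (hφ : φ ∈ atlas (𝔼 n) M) (h : IsIdealHypersurface (x ∘ φ.symm) V N η) (hV : IsPreconnected V)
    (ha : 0 < a) (hp : p ∈ φ.source ∩ φ ⁻¹' V) (hq : q ∈ φ.source ∩ φ ⁻¹' V)
    (hI : HasInvariantsAt x a E C p) : HasInvariantsAt x a E C q := by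
  obtain ⟨s, hs, hI⟩ := h.exists_hasInvariants hx hφ hp.1 hp.2 hI
  exact (h.smul hs).hasInvariantsAt hx hφ hq.1 hq.2
    ((h.smul hs).hasInvariants_of_hasInvariants hn hV ha hp.2 hq.2 hI)

theorem pow_four_le (hn : 3 ≤ n) (hx : IsSmoothImmersion (n := n) x) (hφ : φ ∈ atlas (𝔼 n) M)
    (h : IsIdealHypersurface (x ∘ φ.symm) V N η) (hp : p ∈ φ.source) (hpV : φ p ∈ V)
    (hI : HasInvariantsAt x a E C p) :
    a ^ 4 / 4 ≤ idealCurvature (x ∘ φ.symm) N (φ p) * slopeBound (x ∘ φ.symm) N (φ p)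
      + idealCurvature (x ∘ φ.symm) N (φ p) ^ 4 := by
  obtain ⟨s, hs, hI⟩ := h.exists_hasInvariants hx hφ hp hpV hI
  rw [← hI.energy]
  gcongr
  exact (h.smul hs).principalSlope_sq_le hn hpV

end IsIdealHypersurface

end Manifold

section Propagation

variable {n : ℕ} {M : Type*} [TopologicalSpace M] [ChartedSpace (𝔼 n) M]
  [IsManifold 𝓘(ℝ, 𝔼 n) ∞ M] {x : M → 𝔼 (n + 1)} {φ : OpenPartialHomeomorph M (𝔼 n)}
  {V : Set (𝔼 n)} {N : 𝔼 n → 𝔼 (n + 1)} {p q : M} {a : ℝ} {E C : 𝔼 (n + 1)}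

theorem IsCasoratiIdeal.exists_isOrientedIdealHypersurface (hn : 2 ≤ n)
    (hx : IsSmoothImmersion (n := n) x) (hideal : IsCasoratiIdeal (n := n) x)
    (hφ : φ ∈ atlas (𝔼 n) M) (hq : q ∈ φ.source) :
    ∃ V, φ q ∈ V ∧ ∃ N, IsOrientedIdealHypersurface (x ∘ φ.symm) V N := by
  have himm : IsImmersionOn (x ∘ φ.symm) φ.target :=
    ⟨φ.open_target, fun y hy => (hx.contDiffOn_comp_symm hφ).contDiffAt (φ.open_target.mem_nhds hy),
      fun y hy => hx.fderiv_comp_symm_injective hφ hy⟩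
  obtain ⟨V, hV, hqV, N, h⟩ := himm.exists_isOrientedHypersurface (φ.map_source hq)
  refine ⟨V, hqV, N, h, fun y hy => ?_⟩
  have hid := hideal φ hφ (φ.symm y) (φ.map_target (hV hy))
  rw [φ.right_inv (hV hy)] at hid
  obtain ⟨l, η, hη⟩ := h.exists_isIdealShape hn hy hid
  exact ⟨η, hη.idealCurvature_eq (h.injective y hy) ▸ hη⟩

namespace HasInvariantsAt

theorem idealCurvature_ne_zero (hx : IsSmoothImmersion (n := n) x) (hφ : φ ∈ atlas (𝔼 n) M)
    (h : IsOrientedIdealHypersurface (x ∘ φ.symm) V N) (hp : p ∈ φ.source ∩ φ ⁻¹' V)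
    (hI : HasInvariantsAt x a E C p) : idealCurvature (x ∘ φ.symm) N (φ p) ≠ 0 := by
  obtain ⟨W, ν, l, v, hpW, hν, hl, -⟩ := hI
  intro h0
  have hlp : l p = 0 := by
    rcases (h.isIdealOrientation hx hφ).eventuallyEq_or_eventuallyEq_neg hx hν hp hpW with h' | h'
    · exact h'.2.self_of_nhds.trans h0
    · exact h'.2.self_of_nhds.trans (neg_eq_zero.2 h0)
  exact hl.ne' hlp

theorem pow_four_le (hn : 3 ≤ n) (hx : IsSmoothImmersion (n := n) x) (hφ : φ ∈ atlas (𝔼 n) M)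
    (h : IsOrientedIdealHypersurface (x ∘ φ.symm) V N) (hp : p ∈ φ.source ∩ φ ⁻¹' V)
    (hI : HasInvariantsAt x a E C p) :
    a ^ 4 / 4 ≤ |idealCurvature (x ∘ φ.symm) N (φ p)| * slopeBound (x ∘ φ.symm) N (φ p)
      + idealCurvature (x ∘ φ.symm) N (φ p) ^ 4 := by
  obtain ⟨V', hpV', N', hN', η, hη⟩ :=
    h.exists_isIdealHypersurface_of_ne_zero hp.2 (hI.idealCurvature_ne_zero hx hφ h hp)
  have habs := abs_of_pos (hη.idealCurvature_pos _ hpV')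
  have hle := hη.pow_four_le hn hx hφ hp.1 hpV' hI
  nth_rw 1 [← habs] at hle
  rcases hN' with rfl | rfl
  · exact hle
  · rwa [slopeBound_neg, idealCurvature_neg, Pi.neg_apply, abs_neg, Even.neg_pow (by decide)] at hle

end HasInvariantsAt

theorem eventually_hasInvariantsAt_iff_of_ne_zero (hn : 3 ≤ n) (hx : IsSmoothImmersion (n := n) x)
    (hφ : φ ∈ atlas (𝔼 n) M) (h : IsOrientedIdealHypersurface (x ∘ φ.symm) V N) (ha : 0 < a)
    (hq : q ∈ φ.source ∩ φ ⁻¹' V) (h0 : idealCurvature (x ∘ φ.symm) N (φ q) ≠ 0) :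
    ∀ᶠ p in 𝓝 q, HasInvariantsAt x a E C p ↔ HasInvariantsAt x a E C q := by
  obtain ⟨V', hqV', N', -, η, hη⟩ := h.exists_isIdealHypersurface_of_ne_zero hq.2 h0
  obtain ⟨ε, hε, hball⟩ := Metric.isOpen_iff.1 hη.isOpen _ hqV'
  have hη_ball := hη.mono Metric.isOpen_ball hball
  have hconn : IsPreconnected (Metric.ball (φ q) ε) := (convex_ball _ _).isPreconnected
  have hq_ball : q ∈ φ.source ∩ φ ⁻¹' Metric.ball (φ q) ε := ⟨hq.1, Metric.mem_ball_self hε⟩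
  filter_upwards [(φ.continuousOn.isOpen_inter_preimage φ.open_source Metric.isOpen_ball).mem_nhds
    hq_ball] with p hp
  exact ⟨hη_ball.hasInvariantsAt_of_hasInvariantsAt hn hx hφ hconn ha hp hq_ball,
    hη_ball.hasInvariantsAt_of_hasInvariantsAt hn hx hφ hconn ha hq_ball hp⟩

theorem eventually_not_hasInvariantsAt_of_eq_zero (hn : 3 ≤ n) (hx : IsSmoothImmersion (n := n) x)
    (hφ : φ ∈ atlas (𝔼 n) M) (h : IsOrientedIdealHypersurface (x ∘ φ.symm) V N) (ha : 0 < a)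
    (hq : q ∈ φ.source ∩ φ ⁻¹' V) (h0 : idealCurvature (x ∘ φ.symm) N (φ q) = 0) :
    ∀ᶠ p in 𝓝 q, ¬ HasInvariantsAt x a E C p := by
  let B : 𝔼 n → ℝ := fun y => |idealCurvature (x ∘ φ.symm) N y| * slopeBound (x ∘ φ.symm) N y
    + idealCurvature (x ∘ φ.symm) N y ^ 4
  have hκ := (h.contDiffAt_idealCurvature hq.2).continuousAt
  have hB : ContinuousAt (B ∘ φ) q :=
    ((hκ.abs.mul (h.continuousAt_slopeBound hq.2)).add (hκ.pow 4)).comp (φ.continuousAt hq.1)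
  have hBq : (B ∘ φ) q < a ^ 4 / 4 := by
    simp only [B, Function.comp_apply, h0, abs_zero, zero_mul, zero_add, zero_pow four_ne_zero]
    positivity
  filter_upwards [hB.eventually_lt_const hBq,
    (φ.continuousOn.isOpen_inter_preimage φ.open_source h.isOpen).mem_nhds hq] with p hBp hp hI
  exact hBp.not_ge (hI.pow_four_le hn hx hφ h hp)

theorem IsCasoratiIdeal.hasInvariantsAt_of_hasInvariantsAt [PreconnectedSpace M] (hn : 3 ≤ n)
    (hx : IsSmoothImmersion (n := n) x) (hideal : IsCasoratiIdeal (n := n) x) (ha : 0 < a)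
    (hI : HasInvariantsAt x a E C p) (q : M) : HasInvariantsAt x a E C q := by
  have hloc : IsLocallyConstant (HasInvariantsAt x a E C) := by
    refine (IsLocallyConstant.iff_eventually_eq _).2 fun q => ?_
    have hφ := chart_mem_atlas (𝔼 n) q
    have hq := mem_chart_source (𝔼 n) q
    obtain ⟨V, hqV, N, h⟩ := hideal.exists_isOrientedIdealHypersurface (by lia) hx hφ hq
    by_cases h0 : idealCurvature (x ∘ (chartAt (𝔼 n) q).symm) N (chartAt (𝔼 n) q q) = 0
    · have hnot := eventually_not_hasInvariantsAt_of_eq_zero (E := E) (C := C) hn hx hφ h ha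
        ⟨hq, hqV⟩ h0
      filter_upwards [hnot] with p hp
      exact propext (iff_of_false hp hnot.self_of_nhds)
    · exact (eventually_hasInvariantsAt_iff_of_ne_zero hn hx hφ h ha ⟨hq, hqV⟩ h0).mono
        fun _ => propext
  exact hloc.apply_eq_of_preconnectedSpace p q ▸ hI

end Propagation

/-! ### The classification -/

section Classification

variable {n : ℕ}

theorem norm_horizontal_sq_add (q : 𝔼 (n + 1)) :
    ‖horizontal q‖ ^ 2 + q (Fin.last n) ^ 2 = ‖q‖ ^ 2 := by
  simp only [EuclideanSpace.real_norm_sq_eq, Fin.sum_univ_castSucc, horizontal_apply]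

theorem exists_orthonormalBasis_last {E : 𝔼 (n + 1)} (hE : ‖E‖ = 1) :
    ∃ b : OrthonormalBasis (Fin (n + 1)) ℝ (𝔼 (n + 1)), b (Fin.last n) = E := by
  have hv : Orthonormal ℝ (({Fin.last n} : Set (Fin (n + 1))).domRestrict fun _ => E) :=
    ⟨fun _ => hE, fun i j hij => absurd (Subsingleton.elim i j) hij⟩
  obtain ⟨b, hb⟩ := hv.exists_orthonormalBasis_extension_of_card_eq (by simp)
  exact ⟨b, hb _ rfl⟩

section

variable {b : OrthonormalBasis (Fin (n + 1)) ℝ (𝔼 (n + 1))} {z : 𝔼 (n + 1)}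

theorem repr_add_smul_last (hz : ⟪b (Fin.last n), z⟫ = 0) (c : ℝ) :
    b.repr (z + c • b (Fin.last n)) (Fin.last n) = c := by
  rw [b.repr_apply_apply, inner_add_right, hz, real_inner_smul_right, real_inner_self_eq_norm_sq,
    b.norm_eq_one, one_pow, mul_one, zero_add]

theorem norm_horizontal_repr_add_smul (hz : ⟪b (Fin.last n), z⟫ = 0) (c : ℝ) :
    ‖horizontal (b.repr (z + c • b (Fin.last n)))‖ = ‖z‖ := by
  have hpyth := norm_horizontal_sq_add (b.repr (z + c • b (Fin.last n)))
  rw [repr_add_smul_last hz, LinearIsometryEquiv.norm_map, norm_add_sq_real,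
    real_inner_smul_right, real_inner_comm, hz, norm_smul, b.norm_eq_one, mul_one,
    Real.norm_eq_abs, sq_abs] at hpyth
  exact (pow_left_inj₀ (norm_nonneg _) (norm_nonneg _) two_ne_zero).1 (by linarith)

end

namespace HasInvariants

section

variable {F : Type*} [NormedAddCommGroup F] [InnerProductSpace ℝ F] {a l m : ℝ} {E C x ν ξ : F}

theorem norm_axis (h : HasInvariants a E C x ν ξ l m) (ha : 0 < a) (hν : ⟪ν, ν⟫ = 1)
    (hξ : ⟪ξ, ξ⟫ = 1) (hξν : ⟪ξ, ν⟫ = 0) : ‖E‖ = 1 := by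
  have hE : ‖E‖ ^ 2 = 1 := by
    rw [← h.axis, ← real_inner_self_eq_norm_sq]
    simp only [real_inner_smul_left, real_inner_smul_right, inner_add_left, inner_add_right, hν, hξ,
      hξν, real_inner_comm ξ ν]
    field_simp
    linear_combination 4 * h.energy
  exact (pow_eq_one_iff_of_nonneg (norm_nonneg _) two_ne_zero).1 hE

theorem inner_axis_radial (h : HasInvariants a E C x ν ξ l m) (hν : ⟪ν, ν⟫ = 1)
    (hξ : ⟪ξ, ξ⟫ = 1) (hξν : ⟪ξ, ν⟫ = 0) :
    ⟪E, (4 / a ^ 4) • ((l * m) • ξ - l ^ 3 • ν)⟫ = 0 := by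
  rw [← h.axis]
  simp only [real_inner_smul_left, real_inner_smul_right, inner_add_left, inner_sub_right, hν, hξ,
    hξν, real_inner_comm ξ ν]
  ring

theorem norm_radial (h : HasInvariants a E C x ν ξ l m) (ha : 0 < a) (hl : 0 < l)
    (hν : ⟪ν, ν⟫ = 1) (hξ : ⟪ξ, ξ⟫ = 1) (hξν : ⟪ξ, ν⟫ = 0) :
    ‖(4 / a ^ 4) • ((l * m) • ξ - l ^ 3 • ν)‖ = 1 / a * (2 * l / a) := by
  refine (pow_left_inj₀ (norm_nonneg _) (by positivity) two_ne_zero).1 ?_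
  rw [← real_inner_self_eq_norm_sq]
  simp only [real_inner_smul_left, real_inner_smul_right, inner_sub_left, inner_sub_right, hν, hξ,
    hξν, real_inner_comm ξ ν]
  field_simp
  linear_combination 16 * h.energy

end

theorem repr_mem_sdHypersurface {a l m : ℝ} {E C x ν ξ : 𝔼 (n + 1)}
    (h : HasInvariants a E C x ν ξ l m) (ha : 0 < a) (hl : 0 < l) (hν : ⟪ν, ν⟫ = 1)
    (hξ : ⟪ξ, ξ⟫ = 1) (hξν : ⟪ξ, ν⟫ = 0)
    {b : OrthonormalBasis (Fin (n + 1)) ℝ (𝔼 (n + 1))} (hb : b (Fin.last n) = E) :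
    b.repr (x - C) ∈ sdHypersurface n a := by
  have hσ := slope_mem_Ioo ha hl h.energy
  have hs := sdDerivInv_mem hσ
  have hx : x - C = (4 / a ^ 4) • ((l * m) • ξ - l ^ 3 • ν)
      + heightOfSlope a (2 / a ^ 2 * m) • b (Fin.last n) := by
    rw [hb, ← h.center]
    abel
  have hinner := h.inner_axis_radial hν hξ hξν
  rw [← hb] at hinner
  refine ⟨sdDerivInv (2 / a ^ 2 * m) / a, ⟨div_pos hs.1 ha, div_lt_div_of_pos_right hs.2 ha⟩,
    ?_, ?_⟩
  · rw [hx, norm_horizontal_repr_add_smul hinner, h.norm_radial ha hl hν hξ hξν, profileRadius,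
      mul_div_cancel₀ _ ha.ne', sd_sdDerivInv hσ (by positivity) (slope_sq_add ha h.energy)]
  · rw [hx, repr_add_smul_last hinner, heightOfSlope]

end HasInvariants

variable {M : Type*} [TopologicalSpace M] [ChartedSpace (𝔼 n) M]

theorem IsSmoothImmersion.comp_isometry {m : ℕ} {x : M → 𝔼 m} (hx : IsSmoothImmersion (n := n) x)
    (A : 𝔼 m ≃ₗᵢ[ℝ] 𝔼 m) (C : 𝔼 m) : IsSmoothImmersion (n := n) fun p => A (x p - C) := by
  have hT : ∀ z, HasFDerivAt (fun z => A (z - C)) (A : 𝔼 m →L[ℝ] 𝔼 m) z := fun z =>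
    (A : 𝔼 m →L[ℝ] 𝔼 m).hasFDerivAt.comp z ((hasFDerivAt_id z).sub_const C)
  have hT_smooth : ContDiff ℝ ∞ fun z => A (z - C) :=
    A.contDiff.comp (contDiff_id.sub contDiff_const)
  refine ⟨hT_smooth.contMDiff.comp hx.1, fun p => ?_⟩
  have hcomp := ((hT (x p)).hasMFDerivAt.comp p
    ((hx.1 p).mdifferentiableAt (by simp)).hasMFDerivAt).mfderiv
  exact hcomp ▸ A.injective.comp (hx.2 p)

variable {x : M → 𝔼 (n + 1)} {p : M} {a : ℝ} {E C : 𝔼 (n + 1)}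

namespace HasInvariantsAt

theorem norm_axis (h : HasInvariantsAt x a E C p) (ha : 0 < a) : ‖E‖ = 1 := by
  obtain ⟨W, ν, l, v, hpW, hν, -, hshape, hI⟩ := h
  have hunit := hν.isUnitNormal p hpW
  exact hI.norm_axis ha hunit.inner_self hshape.inner_self (hunit.inner_eq_zero v)

theorem repr_mem_sdHypersurface (h : HasInvariantsAt x a E C p) (ha : 0 < a)
    {b : OrthonormalBasis (Fin (n + 1)) ℝ (𝔼 (n + 1))} (hb : b (Fin.last n) = E) :
    b.repr (x p - C) ∈ sdHypersurface n a := by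
  obtain ⟨W, ν, l, v, hpW, hν, hl, hshape, hI⟩ := h
  have hunit := hν.isUnitNormal p hpW
  exact hI.repr_mem_sdHypersurface ha hl hunit.inner_self hshape.inner_self
    (hunit.inner_eq_zero v) hb

end HasInvariantsAt

theorem IsOrientedIdealHypersurface.secondFF_eq_zero {X N : 𝔼 n → 𝔼 (n + 1)} {V : Set (𝔼 n)}
    {y : 𝔼 n} (h : IsOrientedIdealHypersurface X V N) (hy : y ∈ V) (h0 : idealCurvature X N y = 0)
    (v w : 𝔼 n) : secondFF X y v w = 0 := by
  obtain ⟨η, hη⟩ := h.exists_isIdealShape y hy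
  rw [h.secondFF_eq hy, ← neg_neg ⟪hess X y v w, N y⟫, ← h.inner_fderiv_normal_fderiv hy,
    hη.map_eq, h0, neg_zero, zero_smul, inner_zero_left, neg_zero, zero_smul]

theorem IsCasoratiIdeal.exists_hasInvariantsAt [IsManifold 𝓘(ℝ, 𝔼 n) ∞ M] (hn : 2 ≤ n)
    (hx : IsSmoothImmersion (n := n) x) (hideal : IsCasoratiIdeal (n := n) x)
    (hgeo : ¬ IsTotallyGeodesic (n := n) x) : ∃ a > 0, ∃ E C p, HasInvariantsAt x a E C p := by
  unfold IsTotallyGeodesic at hgeo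
  push Not at hgeo
  obtain ⟨φ, hφ, p, hp, v, w, hne⟩ := hgeo
  obtain ⟨V, hpV, N, h⟩ := hideal.exists_isOrientedIdealHypersurface hn hx hφ hp
  obtain ⟨V', hpV', N', -, η, hη⟩ := h.exists_isIdealHypersurface_of_ne_zero hpV
    fun h0 => hne (h.secondFF_eq_zero hpV h0 v w)
  have hκ := hη.idealCurvature_pos _ hpV'
  have henergy : 0 < 4 * (principalSlope (x ∘ φ.symm) N' η (φ p) ^ 2
      + idealCurvature (x ∘ φ.symm) N' (φ p) ^ 4) := by positivity
  have ha := Real.rpow_inv_natCast_pow henergy.le four_ne_zero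
  exact ⟨_, Real.rpow_pos_of_pos henergy _, _, _, p,
    hη.hasInvariantsAt hx hφ hp hpV' ⟨by rw [ha]; ring, rfl, rfl⟩⟩

end Classification

end Casorati

end

theorem theorem5p4_general {n : ℕ} (hn : 3 ≤ n) {M : Type*} [TopologicalSpace M]
    [PreconnectedSpace M] [ChartedSpace (EuclideanSpace ℝ (Fin n)) M]
    [IsManifold (modelWithCornersSelf ℝ (EuclideanSpace ℝ (Fin n))) ∞ M]
    (x : M → EuclideanSpace ℝ (Fin (n + 1))) (hx : Casorati.IsSmoothImmersion (n := n) x)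
    (hideal : Casorati.IsCasoratiIdeal (n := n) x)
    (hgeo : ¬ Casorati.IsTotallyGeodesic (n := n) x) :
    ∃ a : ℝ, 0 < a ∧ ∃ T : EuclideanSpace ℝ (Fin (n + 1)) ≃ᵢ EuclideanSpace ℝ (Fin (n + 1)),
      ∃ hT : ∀ p : M, T (x p) ∈ Casorati.sdHypersurface n a,
        IsLocalHomeomorph
          (fun p : M => (⟨T (x p), hT p⟩ : Casorati.sdHypersurface n a)) := by
  obtain ⟨a, ha, E, C, p, hI⟩ := hideal.exists_hasInvariantsAt (by lia) hx hgeo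
  obtain ⟨b, hb⟩ := Casorati.exists_orthonormalBasis_last (hI.norm_axis ha)
  have hmem := fun q =>
    (hideal.hasInvariantsAt_of_hasInvariantsAt hn hx ha hI q).repr_mem_sdHypersurface ha hb
  exact ⟨a, ha, (IsometryEquiv.subRight C).trans b.repr.toIsometryEquiv, hmem,
    Casorati.isLocalHomeomorph_sdHypersurface (hx.comp_isometry b.repr C) hmem⟩

theorem theorem5p4 {M : Type*} [TopologicalSpace M] [T2Space M] [SecondCountableTopology M]
    [ConnectedSpace M] [ChartedSpace (EuclideanSpace ℝ (Fin 3)) M]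
    [IsManifold (modelWithCornersSelf ℝ (EuclideanSpace ℝ (Fin 3))) ∞ M]
    (x : M → EuclideanSpace ℝ (Fin 4)) (hx : Casorati.IsSmoothImmersion (n := 3) x)
    (hideal : Casorati.IsCasoratiIdeal (n := 3) x)
    (hgeo : ¬ Casorati.IsTotallyGeodesic (n := 3) x) :
    ∃ a : ℝ, 0 < a ∧ ∃ T : EuclideanSpace ℝ (Fin 4) ≃ᵢ EuclideanSpace ℝ (Fin 4),
      ∃ hT : ∀ p : M, T (x p) ∈ Casorati.rotHypersurface a,
        IsLocalHomeomorph
          (fun p : M => (⟨T (x p), hT p⟩ : Casorati.rotHypersurface a)) := by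
  rw [Casorati.rotHypersurface_eq_sdHypersurface]
  exact theorem5p4_general le_rfl x hx hideal hgeo
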